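/- **Setting.** Let $V,W$ be real vector spaces of finite dimensions $n\ge 2$ and $m\ge 1$, with positive definite inner products $\langle\cdot,\cdot\rangle$, let $c\in\mathbb R$, and let $\beta\colon V\times V\to W$ be a symmetric bilinear form. Let $\{e_i\}$, $\{\xi_a\}$ be orthonormal bases of $V$ and $W$ (nothing below depends on the choice). Put $\mathcal H_\beta=\frac1n\sum_i\beta(e_i,e_i)$ and $\mathsf H_\beta=\|\mathcal H_\beta\|$. The form $\beta$ is *umbilical* if its traceless part $\mathring\beta=\beta-\langle\cdot,\cdot\rangle\mathcal H_\beta$ vanishes. For $\xi\in W$ let $A_\xi\in\mathrm{End}(V)$ be given by $\langle A_\xi x,y\rangle=\langle\beta(x,y),\xi\rangle$. For bilinear forms $\phi,\psi$ on $V$ with values in an inner product space, the Kulkarni–Nomizu product is $$(\phi\wedge\psi)(x_1,x_2,x_3,x_4)=\langle\phi(x_1,x_3),\psi(x_2,x_4)\rangle+\langle\phi(x_2,x_4),\psi(x_1,x_3)\rangle-\langle\phi(x_1,x_4),\psi(x_2,x_3)\rangle-\langle\phi(x_2,x_3),\psi(x_1,x_4)\rangle .$$ Define $\mathsf R_c(\beta)=\frac12\big(c\,\langle\cdot,\cdot\rangle\wedge\langle\cdot,\cdot\rangle+\beta\wedge\beta\big)$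 and $\mathsf{Ric}_c(\beta)(x,y)=\sum_i\mathsf R_c(\beta)(e_i,x,e_i,y)$. Let $\lambda_{c,1}(\beta)\le\dots\le\lambda_{c,n}(\beta)$ be the eigenvalues, with multiplicity, of the self-adjoint operator $\mathsf T_c(\beta)$ of $V$ given by $\langle\mathsf T_c(\beta)x,y\rangle=\frac1{n-1}\mathsf{Ric}_c(\beta)(x,y)$. Put $$\rho_{c,k}(\beta)=\frac1k\sum_{i=1}^k\lambda_{c,i}(\beta)\quad(1\le k\le n),\qquad \rho_c(\beta)=\rho_{c,n}(\beta),$$ $$\rho^\perp(\beta)=\frac1{n(n-1)}\Big(\sum_{i,j=1}^n\sum_{a,b=1}^m\big\langle[A_{\xi_a},A_{\xi_b}]e_i,e_j\big\rangle^2\Big)^{1/2}.$$ **Proposition.** (i) If $n\ge3$, then for every $k\in\{1,\dots,n-1\}$, $$\rho_{c,k}(\beta)\le c+\mathsf H_\beta^2-\rho^\perp(\beta),$$ and, for each such $k$, equality holds if and only if $\beta$ is umbilical. (ii) For every $\lambda\in[0,1)$, $$\rho_c(\beta)\le c+\mathsf H_\beta^2-\lambda\rho^\perp(\beta),$$ and,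 for each such $\lambda$, equality holds if and only if $\beta$ is umbilical. -/

import Mathlib

open Module

noncomputable section

namespace FormalCurvature

variable {V W : Type*} [NormedAddCommGroup V] [InnerProductSpace ℝ V] [FiniteDimensional ℝ V]
  [NormedAddCommGroup W] [InnerProductSpace ℝ W]

/-- The space `Sym(V × V, W)` of symmetric bilinear forms on `V` with values in `W`. -/
def SymForm (V W : Type*) [NormedAddCommGroup V] [InnerProductSpace ℝ V]
    [NormedAddCommGroup W] [InnerProductSpace ℝ W] : Submodule ℝ (V →ₗ[ℝ] V →ₗ[ℝ] W) where
  carrier := {β | ∀ x y, β x y = β y x}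
  add_mem' := by
    intro a b ha hb x y
    simp only [LinearMap.add_apply]
    rw [ha x y, hb x y]
  zero_mem' := by intro x y; simp
  smul_mem' := by
    intro r a ha x y
    simp only [LinearMap.smul_apply]
    rw [ha x y]

/-- The trace `∑ B(eᵢ, eᵢ)` of a bilinear form over an orthonormal basis of `V`
(see `formTrace_eq_sum` for the independence of the basis). -/
def formTrace {E : Type*} [AddCommGroup E] (B : V → V → E) : E :=
  ∑ i, B (stdOrthonormalBasis ℝ V i) (stdOrthonormalBasis ℝ V i)

theorem formTrace_eq_sum {E : Type*} [AddCommGroup E] [Module ℝ E] (B : V →ₗ[ℝ] V →ₗ[ℝ] E)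
    {ι : Type*} [Fintype ι] (e : OrthonormalBasis ι ℝ V) :
    formTrace (fun x y => B x y) = ∑ i, B (e i) (e i) := by
  classical
  have key : ∀ {κ : Type _} [Fintype κ] (f : OrthonormalBasis κ ℝ V),
      ∑ i, B (f i) (f i) = ∑ j, ∑ k, (inner ℝ (e j) (e k) : ℝ) • B (e j) (e k) := by
    intro κ _ f
    have h1 : ∀ i, B (f i) (f i) =
        ∑ j, ∑ k, ((inner ℝ (e j) (f i) : ℝ) * inner ℝ (f i) (e k)) • B (e j) (e k) := by
      intro i
      conv_lhs => rw [← e.sum_repr' (f i)]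
      simp only [map_sum, LinearMap.sum_apply, map_smul, LinearMap.smul_apply, Finset.smul_sum,
        smul_smul]
      rw [Finset.sum_comm]
      refine Finset.sum_congr rfl fun j _ => Finset.sum_congr rfl fun k _ => ?_
      rw [real_inner_comm (f i) (e k), mul_comm]
    simp only [h1]
    rw [Finset.sum_comm]
    refine Finset.sum_congr rfl fun j _ => ?_
    rw [Finset.sum_comm]
    refine Finset.sum_congr rfl fun k _ => ?_
    rw [← Finset.sum_smul, f.sum_inner_mul_inner]
  unfold formTrace
  rw [key (stdOrthonormalBasis ℝ V)]
  refine Finset.sum_congr rfl fun j _ => ?_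
  simp [orthonormal_iff_ite.mp e.orthonormal]

/-- The endomorphism of `V` that represents a real bilinear form `B` through the inner product
(see `inner_formOperator`). -/
def formOperator (B : V →ₗ[ℝ] V →ₗ[ℝ] ℝ) : V →ₗ[ℝ] V :=
  ∑ i, (B.flip (stdOrthonormalBasis ℝ V i)).smulRight (stdOrthonormalBasis ℝ V i)

theorem inner_formOperator (B : V →ₗ[ℝ] V →ₗ[ℝ] ℝ) (x y : V) :
    inner ℝ (formOperator B x) y = B x y := by
  conv_rhs => rw [← (stdOrthonormalBasis ℝ V).sum_repr' y]
  simp only [formOperator, LinearMap.sum_apply, LinearMap.smulRight_apply, LinearMap.flip_apply,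
    sum_inner, real_inner_smul_left, map_sum, map_smul, smul_eq_mul]
  exact Finset.sum_congr rfl fun i _ => mul_comm _ _

theorem formOperator_isSymmetric {B : V →ₗ[ℝ] V →ₗ[ℝ] ℝ} (hB : ∀ x y, B x y = B y x) :
    (formOperator B).IsSymmetric := by
  intro x y
  rw [inner_formOperator, real_inner_comm, inner_formOperator, hB]

/-- The shape operator `A_ξ(β)`, determined by `⟨A_ξ(β) x, y⟩ = ⟨β(x, y), ξ⟩`. -/
def shapeOperator (β : SymForm V W) (ξ : W) : V →ₗ[ℝ] V :=
  formOperator ((β : V →ₗ[ℝ] V →ₗ[ℝ] W).compr₂ ((innerₗ W) ξ))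

theorem inner_shapeOperator (β : SymForm V W) (ξ : W) (x y : V) :
    inner ℝ (shapeOperator β ξ x) y = inner ℝ (β.1 x y) ξ := by
  rw [shapeOperator, inner_formOperator, real_inner_comm]
  rfl

/-- The Kulkarni–Nomizu product of `W`-valued bilinear forms. For `W = ℝ` it is the product of
real-valued bilinear forms. -/
def kulkarniNomizu (φ ψ : V →ₗ[ℝ] V →ₗ[ℝ] W) (x₁ x₂ x₃ x₄ : V) : ℝ :=
  inner ℝ (φ x₁ x₃) (ψ x₂ x₄) + inner ℝ (φ x₂ x₄) (ψ x₁ x₃)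
    - inner ℝ (φ x₁ x₄) (ψ x₂ x₃) - inner ℝ (φ x₂ x₃) (ψ x₁ x₄)

/-- The formal curvature tensor
`R_c(β) = (1/2) (c ⟨·,·⟩ ∧ ⟨·,·⟩ + β ∧ β)`, with Kulkarni–Nomizu products. -/
def curvature (c : ℝ) (β : SymForm V W) (x₁ x₂ x₃ x₄ : V) : ℝ :=
  1 / 2 * (c * kulkarniNomizu (innerₗ V) (innerₗ V) x₁ x₂ x₃ x₄
    + kulkarniNomizu β.1 β.1 x₁ x₂ x₃ x₄)

/-- The formal Ricci tensor `Ric_c(β)(x, y) = tr R_c(β)(·, x, ·, y)`. -/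
def ricci (c : ℝ) (β : SymForm V W) : SymForm V ℝ :=
  ⟨LinearMap.mk₂ ℝ (fun x y => formTrace fun u v => curvature c β u x v y)
    (by
      intro x x' y
      simp only [formTrace, ← Finset.sum_add_distrib]
      refine Finset.sum_congr rfl fun i _ => ?_
      simp only [curvature, kulkarniNomizu, map_add, LinearMap.add_apply, inner_add_left,
        inner_add_right]
      ring)
    (by
      intro r x y
      simp only [formTrace, smul_eq_mul, Finset.mul_sum]
      refine Finset.sum_congr rfl fun i _ => ?_
      simp only [curvature, kulkarniNomizu, map_smul, LinearMap.smul_apply, inner_smul_left,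
        inner_smul_right, conj_trivial]
      ring)
    (by
      intro x y y'
      simp only [formTrace, ← Finset.sum_add_distrib]
      refine Finset.sum_congr rfl fun i _ => ?_
      simp only [curvature, kulkarniNomizu, map_add, inner_add_left, inner_add_right]
      ring)
    (by
      intro r x y
      simp only [formTrace, smul_eq_mul, Finset.mul_sum]
      refine Finset.sum_congr rfl fun i _ => ?_
      simp only [curvature, kulkarniNomizu, map_smul, inner_smul_left, inner_smul_right,
        conj_trivial]
      ring),
   by
    intro x y
    simp only [LinearMap.mk₂_apply, formTrace]
    refine Finset.sum_congr rfl fun i _ => ?_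
    have h : ∀ a b, β.1 a b = β.1 b a := β.2
    have h' : ∀ a b : V, innerₗ V a b = innerₗ V b a := fun a b => real_inner_comm b a
    simp only [curvature, kulkarniNomizu]
    set e := stdOrthonormalBasis ℝ V i
    rw [h x y, h' x y, h x e, h' x e, h e y, h' e y, real_inner_comm (β.1 y e) (β.1 e x),
      real_inner_comm (innerₗ V y e) (innerₗ V e x)]⟩

/-- The normalized Ricci operator `T_c(β)`, determined by
`⟨T_c(β) x, y⟩ = Ric_c(β)(x, y) / (n - 1)`. -/
def ricciOperator (c : ℝ) (β : SymForm V W) : V →ₗ[ℝ] V :=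
  formOperator ((1 / ((finrank ℝ V : ℝ) - 1)) • (ricci c β).1)

theorem ricciOperator_isSymmetric (c : ℝ) (β : SymForm V W) :
    (ricciOperator c β).IsSymmetric :=
  formOperator_isSymmetric ((1 / ((finrank ℝ V : ℝ) - 1)) • ricci c β).2

/-- The eigenvalues of `T_c(β)` with multiplicity, in increasing order (Mathlib lists the
eigenvalues of a symmetric operator in decreasing order). -/
def ricciEigenvalue (c : ℝ) (β : SymForm V W) (i : Fin (finrank ℝ V)) : ℝ :=
  (ricciOperator_isSymmetric c β).eigenvalues rfl i.rev

/-- The formal `k`-th scalar curvature `ρ_{c,k}(β)`: the mean of the `k` smallest eigenvalues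
of `T_c(β)`. -/
def partialScalarCurvature (c : ℝ) (k : ℕ) (β : SymForm V W) : ℝ :=
  1 / (k : ℝ) * ∑ i ∈ Finset.univ.filter (fun i : Fin (finrank ℝ V) => (i : ℕ) < k), ricciEigenvalue c β i

/-- The formal normalized scalar curvature `ρ_c(β) = ρ_{c,n}(β)`. -/
def scalarCurvature (c : ℝ) (β : SymForm V W) : ℝ :=
  partialScalarCurvature c (finrank ℝ V) β

/-- The formal normal curvature tensor
`R^⊥(β)(x, y, ξ, η) = ⟨[A_ξ(β), A_η(β)] x, y⟩`. -/
def normalCurvature (β : SymForm V W) (x y : V) (ξ η : W) : ℝ :=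
  inner ℝ ((shapeOperator β ξ ∘ₗ shapeOperator β η
    - shapeOperator β η ∘ₗ shapeOperator β ξ) x) y

/-- The formal normal scalar curvature `ρ^⊥(β) = ‖R^⊥(β)‖ / (n (n - 1))`, where `‖·‖` is the
Euclidean norm of the components in orthonormal bases. -/
def normalScalarCurvature [FiniteDimensional ℝ W] (β : SymForm V W) : ℝ :=
  1 / ((finrank ℝ V : ℝ) * ((finrank ℝ V : ℝ) - 1)) *
    Real.sqrt (∑ i, ∑ j, ∑ a, ∑ b,
      (normalCurvature β (stdOrthonormalBasis ℝ V i) (stdOrthonormalBasis ℝ V j)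
        (stdOrthonormalBasis ℝ W a) (stdOrthonormalBasis ℝ W b)) ^ 2)

/-- The mean curvature vector `𝓗_β = (1/n) tr β`. -/
def meanCurvatureVector (β : SymForm V W) : W :=
  (1 / (finrank ℝ V : ℝ)) • formTrace fun x y => β.1 x y

/-- The mean curvature `H_β = ‖𝓗_β‖`. -/
def meanCurvature (β : SymForm V W) : ℝ := ‖meanCurvatureVector β‖

/-- The traceless part `β - ⟨·,·⟩ 𝓗_β` of `β`. -/
def tracelessPart (β : SymForm V W) : V →ₗ[ℝ] V →ₗ[ℝ] W :=
  β.1 - (innerₗ V).compr₂ (LinearMap.toSpanSingleton ℝ W (meanCurvatureVector β))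

theorem tracelessPart_apply (β : SymForm V W) (x y : V) :
    tracelessPart β x y = β.1 x y - (inner ℝ x y : ℝ) • meanCurvatureVector β := rfl

/-- The form `β` is umbilical if its traceless part vanishes. -/
def IsUmbilical (β : SymForm V W) : Prop := tracelessPart β = 0

end FormalCurvature

end

open FormalCurvature

/-!
Let `B a` be the matrices of the traceless shape operators in orthonormal bases, `S = ∑ ‖B a‖²`
(`totalSq`) and `G = ∑ ‖⁅B a, B b⁆‖²` (`commSq`), in Frobenius norms. The trace of the Gauss
equation gives `ρ = c + H² - S / (n (n - 1))` (`scalarCurvature_eq`), and multiples of the identity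
do not affect commutators, so `ρ^⊥ = √G / (n (n - 1))` (`normalScalarCurvature_eq`). Part (ii)
therefore amounts to the DDVV inequality `G ≤ S²` (`commSq_le_totalSq_sq`) together with the fact
that `S = 0` means umbilical: for a factor `l < 1`, equality forces `S ≤ l S`. In part (i),
`ρ_k ≤ ρ` because the eigenvalues are listed in increasing order.

The DDVV inequality is proved by Lu's variational argument. Let `M` be the maximum of `G` on the
compact sphere `S = 1`. A maximizer can be rotated, in `W` and in `V`, so that the `B a` are mutually
orthogonal and a largest one is `diagonal η`, with `N = ∑ η i ^ 2`. Rescaling only this member gives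
the first variation `M S N = ∑ b, ‖⁅B a₀, B b⁆‖²` (`sum_frobSq_lie_eq_of_extremal`). The right-hand
side is `∑ (η i - η j)² q i j`, where `q i j` is the sum over the family of the squared `(i, j)`
entries, and Bessel's inequality gives `q i j ≤ N / 2` for `i ≠ j`. Pairs with `(η i - η j)² > N`
all share one vertex, and the Laplacian of a star with `s` leaves has norm `s + 1`; hence the sum is
at most `N S` (`sum_sq_sub_mul_le`, `IsNormalPosition.sum_frobSq_lie_le`), and `M ≤ 1`.

Equality `G = S² ≠ 0` makes all these estimates sharp: `η` is, up to order, proportional to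
`(-s, 1, …, 1, 0, …, 0)` and the other matrices live on the edges of the star. If the star misses an
index, the corresponding basis vector lies in the kernel of every `B a`; a star of `n - 1 ≥ 2` leaves
violates the first variation at another member. So for `n ≥ 3` there is a common kernel vector `x`
(`exists_common_kernel_of_commSq_eq`), and the Gauss equation gives
`Ric(x, x) = (n - 1) (c + H²) ‖x‖²`. Equality in (i) also forces `ρ_k = ρ`, so the Ricci tensor is
`(n - 1) ρ ⟨·, ·⟩`. Comparing the two, `ρ = c + H²`, which means `S = 0`.
-/

section

open Finset Matrix FormalCurvature

/-! ### Differences of real numbers on a star graph -/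

/-- Call `i, j` an edge when `(η i - η j) ^ 2` exceeds `∑ k, η k ^ 2`. Two edges are never disjoint
and three edges never form a triangle, so all edges meet in one vertex `o`. -/
theorem exists_star_center {ι : Type*} [Fintype ι] [DecidableEq ι] [Nonempty ι] (η : ι → ℝ) :
    ∃ o, ∀ i j, i ≠ o → j ≠ o → (η i - η j) ^ 2 ≤ ∑ k, η k ^ 2 := by
  set N := ∑ k, η k ^ 2 with hN
  have hsub : ∀ s : Finset ι, ∑ k ∈ s, η k ^ 2 ≤ N := fun s =>
    Finset.sum_le_univ_sum_of_nonneg fun k => sq_nonneg _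
  have hN0 : 0 ≤ N := Finset.sum_nonneg fun k _ => sq_nonneg _
  let E : ι → ι → Prop := fun i j => N < (η i - η j) ^ 2
  have hsymm : ∀ i j, E i j → E j i := by
    intro i j h
    simp only [E] at *
    linarith [sub_sq_comm (η i) (η j)]
  have hirr : ∀ i, ¬ E i i := by
    intro i; simp only [E]; simp [hN0]
  have hdisj : ∀ a b c d, E a b → E c d → a = c ∨ a = d ∨ b = c ∨ b = d := by
    intro a b c d h1 h2
    by_contra! h
    obtain ⟨h3, h4, h5, h6⟩ := h
    have hab : a ≠ b := fun h => hirr b (h ▸ h1)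
    have hcd : c ≠ d := fun h => hirr d (h ▸ h2)
    have := hsub {a, b, c, d}
    rw [Finset.sum_insert (by simp [*]), Finset.sum_insert (by simp [*]),
      Finset.sum_insert (by simp [*]), Finset.sum_singleton] at this
    simp only [E] at h1 h2
    nlinarith [sq_nonneg (η a + η b), sq_nonneg (η c + η d)]
  have htri : ∀ a b c, E a b → E b c → ¬ E a c := by
    intro a b c h1 h2 h3
    have hab : a ≠ b := fun h => hirr b (h ▸ h1)
    have hbc : b ≠ c := fun h => hirr c (h ▸ h2)
    have hac : a ≠ c := fun h => hirr c (h ▸ h3)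
    have := hsub {a, b, c}
    rw [Finset.sum_insert (by simp [*]), Finset.sum_insert (by simp [*]),
      Finset.sum_singleton] at this
    simp only [E] at h1 h2 h3
    nlinarith [sq_nonneg (η a + η b + η c)]
  -- An edge `a b`, an edge avoiding `a` and an edge avoiding `b` would contain a disjoint pair or
  -- a triangle.
  by_contra! hcon
  have hc : ∀ o, ∃ i j, i ≠ o ∧ j ≠ o ∧ E i j := hcon
  clear_value E
  obtain ⟨a, b, -, -, hab⟩ := hc (Classical.arbitrary ι)
  obtain ⟨c, d, hca, hda, hcd⟩ := hc a
  obtain ⟨e, f, heb, hfb, hef⟩ := hc b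
  clear hcon hc hsub hN hN0
  have h1 := hdisj a b c d hab hcd
  have h2 := hdisj a b e f hab hef
  have h3 := hdisj c d e f hcd hef
  grind

theorem sum_const_sub_sq {ι : Type*} (η : ι → ℝ) (x : ℝ) (J : Finset ι) :
    ∑ j ∈ J, (x - η j) ^ 2 = #J * x ^ 2 - 2 * x * ∑ j ∈ J, η j + ∑ j ∈ J, η j ^ 2 := by
  simp only [sub_sq, Finset.sum_sub_distrib, Finset.sum_add_distrib, Finset.sum_const,
    nsmul_eq_mul, ← Finset.mul_sum]

/-- The Laplacian of a star with `#J` leaves has norm `#J + 1`, written as an identity with explicit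
nonnegative remainder (the middle bracket is nonnegative by the Cauchy-Schwarz inequality). -/
theorem star_sum_identity {ι : Type*} [Fintype ι] [DecidableEq ι] (η : ι → ℝ) (o : ι)
    (J : Finset ι) (hJ : o ∉ J) :
    (∑ k, η k ^ 2) - ∑ j ∈ J, ((η o - η j) ^ 2 - ∑ k, η k ^ 2) =
      (η o + ∑ j ∈ J, η j) ^ 2 + (#J * ∑ j ∈ J, η j ^ 2 - (∑ j ∈ J, η j) ^ 2)
        + (#J + 1) * ∑ k ∈ (insert o J)ᶜ, η k ^ 2 := by
  have h := Finset.sum_add_sum_compl (insert o J) fun k => η k ^ 2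
  rw [Finset.sum_insert hJ] at h
  have h2 : ∑ j ∈ J, ((η o - η j) ^ 2 - ∑ k, η k ^ 2) =
      #J * η o ^ 2 - 2 * η o * ∑ j ∈ J, η j + ∑ j ∈ J, η j ^ 2 - #J * ∑ k, η k ^ 2 := by
    rw [Finset.sum_sub_distrib, sum_const_sub_sq, Finset.sum_const, nsmul_eq_mul]
  rw [h2, ← h]
  ring

/-- If all remainders in `star_sum_identity` vanish, then `η` is the top eigenvector of the Laplacian
of the star: constant on the leaves, zero outside, and of sum zero. -/
theorem eq_const_of_star_sum_eq {ι : Type*} [Fintype ι] [DecidableEq ι] (η : ι → ℝ) (o : ι)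
    (J : Finset ι) (hJ : o ∉ J) (hpos : 0 < #J)
    (h : ∑ j ∈ J, ((η o - η j) ^ 2 - ∑ k, η k ^ 2) = ∑ k, η k ^ 2) :
    ∃ y, η o = -(#J * y) ∧ (∀ j ∈ J, η j = y) ∧ ∀ k, k ≠ o → k ∉ J → η k = 0 := by
  have hid := star_sum_identity η o J hJ
  rw [h, sub_self] at hid
  have hcs : (∑ j ∈ J, η j) ^ 2 ≤ #J * ∑ j ∈ J, η j ^ 2 := sq_sum_le_card_mul_sum_sq
  have hout : 0 ≤ ∑ k ∈ (insert o J)ᶜ, η k ^ 2 := Finset.sum_nonneg fun k _ => sq_nonneg _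
  have hout' : 0 ≤ ((#J : ℝ) + 1) * ∑ k ∈ (insert o J)ᶜ, η k ^ 2 := by positivity
  have hJR : (0 : ℝ) < #J := by exact_mod_cast hpos
  have hsq := sq_nonneg (η o + ∑ j ∈ J, η j)
  have hz1 : η o + ∑ j ∈ J, η j = 0 :=
    pow_eq_zero_iff two_ne_zero |>.mp (by linarith)
  have hz2 : (#J * ∑ j ∈ J, η j ^ 2) = (∑ j ∈ J, η j) ^ 2 := by linarith
  have hz3 : ∑ k ∈ (insert o J)ᶜ, η k ^ 2 = 0 :=
    (mul_eq_zero.mp (by linarith : ((#J : ℝ) + 1) * ∑ k ∈ (insert o J)ᶜ, η k ^ 2 = 0)).resolve_left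
      (by linarith)
  obtain ⟨y, hsumy⟩ : ∃ y : ℝ, ∑ j ∈ J, η j = #J * y := 
    ⟨(∑ j ∈ J, η j) / #J, (mul_div_cancel₀ _ hJR.ne').symm⟩
  refine ⟨y, by linarith, ?_, ?_⟩
  · have h3 : ∑ j ∈ J, (η j - y) ^ 2 =
        ∑ j ∈ J, η j ^ 2 - 2 * y * ∑ j ∈ J, η j + #J * y ^ 2 := by
      rw [Finset.sum_congr rfl fun j _ => sub_sq_comm (η j) y, sum_const_sub_sq]
      ring
    rw [hsumy] at hz2 h3
    have h4 : ∑ j ∈ J, η j ^ 2 = #J * y ^ 2 := by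
      apply mul_left_cancel₀ hJR.ne'
      rw [hz2]; ring
    have h5 : ∑ j ∈ J, (η j - y) ^ 2 = 0 := by rw [h3, h4]; ring
    intro j hj
    have := (Finset.sum_eq_zero_iff_of_nonneg fun j _ => sq_nonneg (η j - y)).mp h5 j hj
    exact sub_eq_zero.mp (pow_eq_zero_iff two_ne_zero |>.mp this)
  · intro k hk hkJ
    have := (Finset.sum_eq_zero_iff_of_nonneg fun k _ => sq_nonneg (η k)).mp hz3 k
      (by simp [hk, hkJ])
    exact pow_eq_zero_iff two_ne_zero |>.mp this

/-- The weighted inequality behind the bound on commutators with a diagonal matrix: if `q` has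
off-diagonal entries at most `N / 2`, where `N = ∑ k, η k ^ 2`, then
`∑ (η i - η j) ^ 2 * q i j ≤ N * ∑_{i ≠ j} q i j + N ^ 2`. Only pairs with `(η i - η j) ^ 2 > N` can
contribute an excess; they form a star with leaves `J`, and `star_sum_identity` bounds its total
excess. In the equality case `η` is supported on the star and `q` on its edges (up to pairs
with `(η i - η j) ^ 2 = N`). -/
theorem sum_sq_sub_mul_le {ι : Type*} [Fintype ι] [DecidableEq ι] (η : ι → ℝ) (q : ι → ι → ℝ)
    (hsymm : ∀ i j, q i j = q j i) (hnonneg : ∀ i j, 0 ≤ q i j)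
    (hq : ∀ i j, i ≠ j → q i j ≤ (∑ k, η k ^ 2) / 2) (hN : 0 < ∑ k, η k ^ 2) :
    ∑ i, ∑ j, (η i - η j) ^ 2 * q i j ≤
        (∑ k, η k ^ 2) * (∑ i, ∑ j, if i = j then 0 else q i j) + (∑ k, η k ^ 2) ^ 2 ∧
      (∑ i, ∑ j, (η i - η j) ^ 2 * q i j =
        (∑ k, η k ^ 2) * (∑ i, ∑ j, if i = j then 0 else q i j) + (∑ k, η k ^ 2) ^ 2 →
        ∃ (o : ι) (J : Finset ι) (y : ℝ), o ∉ J ∧ 0 < #J ∧ η o = - (#J * y) ∧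
          (∀ j ∈ J, η j = y ∧ q o j = (∑ k, η k ^ 2) / 2) ∧
          (∀ k, k ≠ o → k ∉ J → η k = 0) ∧
          ∀ i j, i ≠ j → (η i - η j) ^ 2 < ∑ k, η k ^ 2 → q i j = 0) := by
  set N := ∑ k, η k ^ 2 with hNdef
  have hne : Nonempty ι := by
    by_contra h
    rw [not_nonempty_iff] at h
    simp [hNdef] at hN
  obtain ⟨o, ho⟩ := exists_star_center η
  rw [← hNdef] at ho
  set J : Finset ι := Finset.univ.filter fun j => j ≠ o ∧ N < (η o - η j) ^ 2 with hJdef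
  have hoJ : o ∉ J := by simp [hJdef]
  -- `t` is the excess of a pair, and `r` majorizes it: the excess `e` of the edges, with weight
  -- `N / 2`, placed in the row and the column of the centre.
  let e : ι → ℝ := fun j => if j ∈ J then ((η o - η j) ^ 2 - N) * (N / 2) else 0
  let t : ι → ι → ℝ := fun i j => if i = j then 0 else ((η i - η j) ^ 2 - N) * q i j
  let r : ι → ι → ℝ := fun i j => (if i = o then e j else 0) + (if j = o then e i else 0)
  have heo : e o = 0 := by simp [e, hoJ]
  have hJ : ∀ j, j ≠ o → (η o - η j) ^ 2 ≤ N ∨ j ∈ J := by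
    intro j hj
    by_cases h : N < (η o - η j) ^ 2
    · right; simp [hJdef, hj, h]
    · left; exact not_lt.mp h
  have hJ' : ∀ j ∈ J, N < (η o - η j) ^ 2 := by
    intro j hj; simp only [hJdef, Finset.mem_filter] at hj; exact hj.2.2
  have hstar : ∀ j, j ≠ o → ((η o - η j) ^ 2 - N) * q o j ≤ e j := by
    intro j hj
    by_cases hjJ : j ∈ J
    · simp only [e, hjJ, if_true]
      exact mul_le_mul_of_nonneg_left (hq o j hj.symm) (by linarith [hJ' j hjJ])
    · simp only [e, hjJ, if_false]
      exact mul_nonpos_of_nonpos_of_nonneg (by have := (hJ j hj).resolve_right hjJ; linarith)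
        (hnonneg _ _)
  have htr : ∀ i j, t i j ≤ r i j := by
    intro i j
    simp only [t, r]
    by_cases hij : i = j
    · subst hij
      by_cases hi : i = o
      · subst hi; simp [heo]
      · simp [hi]
    rw [if_neg hij]
    by_cases hi : i = o
    · subst hi
      rw [if_pos rfl, if_neg (Ne.symm hij), add_zero]
      exact hstar j (Ne.symm hij)
    · by_cases hj : j = o
      · subst hj
        rw [if_neg hi, if_pos rfl, zero_add, hsymm, sub_sq_comm]
        exact hstar i hi
      · rw [if_neg hi, if_neg hj, add_zero]
        exact mul_nonpos_of_nonpos_of_nonneg (by have := ho i j hi hj; linarith) (hnonneg _ _)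
  have hsumt : ∑ i, ∑ j, (η i - η j) ^ 2 * q i j =
      N * (∑ i, ∑ j, if i = j then 0 else q i j) + ∑ i, ∑ j, t i j := by
    simp only [Finset.mul_sum, ← Finset.sum_add_distrib]
    refine Finset.sum_congr rfl fun i _ => Finset.sum_congr rfl fun j _ => ?_
    simp only [t]
    split_ifs with h
    · simp [h]
    · ring
  have hsume : ∑ j, e j = (N / 2) * ∑ j ∈ J, ((η o - η j) ^ 2 - N) := by
    simp only [e, Finset.sum_ite_mem, Finset.univ_inter, ← Finset.sum_mul]
    exact mul_comm _ _
  have hsumr : ∑ i, ∑ j, r i j = N * ∑ j ∈ J, ((η o - η j) ^ 2 - N) := by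
    have : ∑ i, ∑ j, r i j = ∑ j, e j + ∑ j, e j := by
      simp only [r, Finset.sum_add_distrib]
      congr 1
      · rw [Finset.sum_comm]; simp
      · simp
    rw [this, hsume]; ring
  have hid := star_sum_identity η o J hoJ
  rw [← hNdef] at hid
  have hcs : (∑ j ∈ J, η j) ^ 2 ≤ #J * ∑ j ∈ J, η j ^ 2 := sq_sum_le_card_mul_sum_sq
  have hout : 0 ≤ ∑ k ∈ (insert o J)ᶜ, η k ^ 2 := Finset.sum_nonneg fun k _ => sq_nonneg _
  have hout' : 0 ≤ ((#J : ℝ) + 1) * ∑ k ∈ (insert o J)ᶜ, η k ^ 2 := by positivity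
  have hle : ∑ j ∈ J, ((η o - η j) ^ 2 - N) ≤ N := by
    nlinarith [sq_nonneg (η o + ∑ j ∈ J, η j)]
  have hle' : ∑ i, ∑ j, t i j ≤ ∑ i, ∑ j, r i j :=
    Finset.sum_le_sum fun i _ => Finset.sum_le_sum fun j _ => htr i j
  have hrN : ∑ i, ∑ j, r i j ≤ N ^ 2 := by
    rw [hsumr, sq]; exact mul_le_mul_of_nonneg_left hle hN.le
  refine ⟨by rw [hsumt]; linarith, fun heq => ?_⟩
  rw [hsumt] at heq
  have h1 : ∑ i, ∑ j, t i j = ∑ i, ∑ j, r i j := by linarith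
  have h2 : ∑ j ∈ J, ((η o - η j) ^ 2 - N) = N := by
    have : N * ∑ j ∈ J, ((η o - η j) ^ 2 - N) = N * N := by rw [← hsumr]; linarith
    exact mul_left_cancel₀ hN.ne' this
  have htr' : ∀ i j, t i j = r i j := by
    intro i j
    have h3 := (Finset.sum_eq_sum_iff_of_le
      (fun i _ => Finset.sum_le_sum fun j _ => htr i j)).mp h1 i (Finset.mem_univ _)
    exact (Finset.sum_eq_sum_iff_of_le (fun j _ => htr i j)).mp h3 j (Finset.mem_univ _)
  have hJpos : 0 < #J := by
    rw [Finset.card_pos]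
    by_contra h
    rw [Finset.not_nonempty_iff_eq_empty] at h
    rw [h, Finset.sum_empty] at h2
    exact hN.ne h2
  obtain ⟨y, hy1, hy2, hy3⟩ := eq_const_of_star_sum_eq η o J hoJ hJpos h2
  refine ⟨o, J, y, hoJ, hJpos, hy1, fun j hj => ⟨hy2 j hj, ?_⟩, hy3, ?_⟩
  · have hjo : j ≠ o := fun h => hoJ (h ▸ hj)
    have := htr' o j
    simp only [t, r, e, if_neg hjo.symm, if_neg hjo, if_true, hj, add_zero] at this
    exact mul_left_cancel₀ (sub_pos.mpr (hJ' j hj)).ne' this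
  · intro i j hij hlt
    have h3 := htr' i j
    have h4 : r i j = 0 := by
      have hi : i = o → j ∉ J := by rintro rfl hj; linarith [hJ' j hj]
      have hj : j = o → i ∉ J := by
        rintro rfl hi'; linarith [hJ' i hi', sub_sq_comm (η i) (η j)]
      simp only [r, e]
      grind
    rw [h4] at h3
    simp only [t, if_neg hij] at h3
    exact (mul_eq_zero.mp h3).resolve_left (by linarith)

/-! ### Families of symmetric matrices in normal position -/

section Frobenius

variable {ι κ : Type*} [Fintype ι] [Fintype κ]

/-- The squared Frobenius norm of a real square matrix. -/
def frobSq (X : Matrix ι ι ℝ) : ℝ := ∑ i, ∑ j, X i j ^ 2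

/-- The sum of the squared Frobenius norms of a family of matrices. -/
def totalSq (B : κ → Matrix ι ι ℝ) : ℝ := ∑ a, frobSq (B a)

/-- The sum of the squared Frobenius norms of all commutators `⁅B a, B b⁆`. -/
def commSq (B : κ → Matrix ι ι ℝ) : ℝ := ∑ a, ∑ b, frobSq ⁅B a, B b⁆

theorem frobSq_nonneg (X : Matrix ι ι ℝ) : 0 ≤ frobSq X :=
  Finset.sum_nonneg fun _ _ => Finset.sum_nonneg fun _ _ => sq_nonneg _

theorem frobSq_eq_trace (X : Matrix ι ι ℝ) : frobSq X = (Xᵀ * X).trace := by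
  simp only [frobSq, Matrix.trace, Matrix.diag, Matrix.mul_apply, Matrix.transpose_apply, sq]
  exact Finset.sum_comm

theorem frobSq_smul (t : ℝ) (X : Matrix ι ι ℝ) : frobSq (t • X) = t ^ 2 * frobSq X := by
  simp [frobSq, mul_pow, Finset.mul_sum]

theorem frobSq_eq_zero {X : Matrix ι ι ℝ} : frobSq X = 0 ↔ X = 0 := by
  constructor
  · intro h
    ext i j
    have h1 := (Finset.sum_eq_zero_iff_of_nonneg fun i _ =>
      Finset.sum_nonneg fun j _ => sq_nonneg (X i j)).mp h i (Finset.mem_univ _)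
    have h2 := (Finset.sum_eq_zero_iff_of_nonneg fun j _ =>
      sq_nonneg (X i j)).mp h1 j (Finset.mem_univ _)
    simpa using h2
  · rintro rfl
    simp [frobSq]

theorem totalSq_nonneg (B : κ → Matrix ι ι ℝ) : 0 ≤ totalSq B :=
  Finset.sum_nonneg fun _ _ => frobSq_nonneg _

theorem totalSq_eq_zero {B : κ → Matrix ι ι ℝ} : totalSq B = 0 ↔ B = 0 := by
  rw [totalSq, Finset.sum_eq_zero_iff_of_nonneg fun _ _ => frobSq_nonneg _, funext_iff]
  simp [frobSq_eq_zero]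

theorem commSq_nonneg (B : κ → Matrix ι ι ℝ) : 0 ≤ commSq B :=
  Finset.sum_nonneg fun _ _ => Finset.sum_nonneg fun _ _ => frobSq_nonneg _

theorem totalSq_smul (t : ℝ) (B : κ → Matrix ι ι ℝ) :
    totalSq (t • B) = t ^ 2 * totalSq B := by
  simp [totalSq, frobSq_smul, Finset.mul_sum]

theorem smul_lie_smul_matrix (s t : ℝ) (X Y : Matrix ι ι ℝ) :
    ⁅s • X, t • Y⁆ = (s * t) • ⁅X, Y⁆ := by
  simp [Ring.lie_def, smul_sub, smul_smul, mul_comm]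

theorem commSq_smul (t : ℝ) (B : κ → Matrix ι ι ℝ) :
    commSq (t • B) = t ^ 4 * commSq B := by
  simp only [commSq, Pi.smul_apply, smul_lie_smul_matrix, frobSq_smul, Finset.mul_sum]
  refine Finset.sum_congr rfl fun a _ => Finset.sum_congr rfl fun b _ => ?_
  ring

theorem sum_mul_eq_trace (X Y : Matrix ι ι ℝ) :
    ∑ i, ∑ j, X i j * Y i j = (Xᵀ * Y).trace := by
  simp only [Matrix.trace, Matrix.diag, Matrix.mul_apply, Matrix.transpose_apply]
  exact Finset.sum_comm

/-- The family obtained from `B` by the change of basis `U` of its index space. -/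
def rotate (U : Matrix κ κ ℝ) (B : κ → Matrix ι ι ℝ) (a : κ) : Matrix ι ι ℝ :=
  ∑ c, U c a • B c

theorem rotate_apply (U : Matrix κ κ ℝ) (B : κ → Matrix ι ι ℝ) (a : κ) (i j : ι) :
    rotate U B a i j = ∑ c, U c a * B c i j := by
  simp [rotate, Matrix.sum_apply]

theorem sum_sq_rotate [DecidableEq κ] {U : Matrix κ κ ℝ} (hU : U * Uᵀ = 1) (x : κ → ℝ) :
    ∑ a, (∑ c, U c a * x c) ^ 2 = ∑ c, x c ^ 2 := by
  have h1 : ∑ a, (∑ c, U c a * x c) ^ 2 = (x ᵥ* U) ⬝ᵥ (x ᵥ* U) := by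
    simp only [dotProduct, vecMul, sq, mul_comm (U _ _)]
  rw [h1, ← Matrix.mulVec_transpose U x, Matrix.dotProduct_mulVec, Matrix.mulVec_transpose,
    Matrix.vecMul_vecMul, hU, Matrix.vecMul_one]
  simp [dotProduct, sq]

theorem totalSq_rotate [DecidableEq κ] {U : Matrix κ κ ℝ} (hU : U * Uᵀ = 1) (B : κ → Matrix ι ι ℝ) :
    totalSq (rotate U B) = totalSq B := by
  have h : ∀ C : κ → Matrix ι ι ℝ, totalSq C = ∑ i, ∑ j, ∑ a, C a i j ^ 2 := by
    intro C
    simp only [totalSq, frobSq]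
    rw [Finset.sum_comm]
    exact Finset.sum_congr rfl fun i _ => Finset.sum_comm
  simp only [h, rotate_apply, sum_sq_rotate hU]

theorem lie_rotate (U : Matrix κ κ ℝ) (B : κ → Matrix ι ι ℝ) (a b : κ) :
    ⁅rotate U B a, rotate U B b⁆ = ∑ c, U c a • ∑ d, U d b • ⁅B c, B d⁆ := by
  have h : ∀ X : Matrix ι ι ℝ, ⁅X, rotate U B b⁆ = ∑ d, U d b • ⁅X, B d⁆ := by
    intro X
    simp only [rotate, Ring.lie_def, Finset.sum_mul, Finset.mul_sum, Matrix.smul_mul,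
      Matrix.mul_smul, smul_sub, Finset.sum_sub_distrib]
  have h' : ∀ X : Matrix ι ι ℝ, ⁅rotate U B a, X⁆ = ∑ c, U c a • ⁅B c, X⁆ := by
    intro X
    simp only [rotate, Ring.lie_def, Finset.sum_mul, Finset.mul_sum, Matrix.smul_mul,
      Matrix.mul_smul, smul_sub, Finset.sum_sub_distrib]
  simp only [h', h]

theorem commSq_rotate [DecidableEq κ] {U : Matrix κ κ ℝ} (hU : U * Uᵀ = 1) (B : κ → Matrix ι ι ℝ) :
    commSq (rotate U B) = commSq B := by
  have h : ∀ K : κ → κ → Matrix ι ι ℝ, ∑ a, ∑ b, frobSq (K a b) =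
      ∑ i, ∑ j, ∑ b, ∑ a, K a b i j ^ 2 := by
    intro K
    simp only [frobSq]
    calc _ = ∑ a, ∑ i, ∑ j, ∑ b, K a b i j ^ 2 := by
          refine Finset.sum_congr rfl fun a _ => ?_
          rw [Finset.sum_comm]
          exact Finset.sum_congr rfl fun i _ => Finset.sum_comm
      _ = _ := by
          rw [Finset.sum_comm]
          refine Finset.sum_congr rfl fun i _ => ?_
          rw [Finset.sum_comm]
          exact Finset.sum_congr rfl fun j _ => Finset.sum_comm
  simp only [commSq, lie_rotate, h, Matrix.sum_apply, Matrix.smul_apply, smul_eq_mul,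
    sum_sq_rotate hU]
  refine Finset.sum_congr rfl fun i _ => Finset.sum_congr rfl fun j _ => ?_
  rw [Finset.sum_comm]
  simp only [sum_sq_rotate hU]
  exact Finset.sum_comm

variable [DecidableEq ι]

theorem frobSq_conj {U : Matrix ι ι ℝ} (hU : U * Uᵀ = 1) (X : Matrix ι ι ℝ) :
    frobSq (Uᵀ * X * U) = frobSq X := by
  rw [frobSq_eq_trace, frobSq_eq_trace]
  have : (Uᵀ * X * U)ᵀ * (Uᵀ * X * U) = Uᵀ * (Xᵀ * X * U) := by
    simp only [Matrix.transpose_mul, Matrix.transpose_transpose, Matrix.mul_assoc]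
    rw [← Matrix.mul_assoc U Uᵀ, hU, Matrix.one_mul]
  rw [this, Matrix.trace_mul_comm, Matrix.mul_assoc, hU, Matrix.mul_one]

theorem lie_conj {U : Matrix ι ι ℝ} (hU : U * Uᵀ = 1) (X Y : Matrix ι ι ℝ) :
    ⁅Uᵀ * X * U, Uᵀ * Y * U⁆ = Uᵀ * ⁅X, Y⁆ * U := by
  have h : ∀ X Y : Matrix ι ι ℝ, (Uᵀ * X * U) * (Uᵀ * Y * U) = Uᵀ * (X * Y) * U := by
    intro X Y
    simp only [Matrix.mul_assoc]
    rw [← Matrix.mul_assoc U Uᵀ, hU, Matrix.one_mul]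
  rw [Ring.lie_def, Ring.lie_def, h, h, Matrix.mul_sub, Matrix.sub_mul]

theorem totalSq_conj {U : Matrix ι ι ℝ} (hU : U * Uᵀ = 1) (B : κ → Matrix ι ι ℝ) :
    totalSq (fun a => Uᵀ * B a * U) = totalSq B := by
  simp only [totalSq, frobSq_conj hU]

theorem commSq_conj {U : Matrix ι ι ℝ} (hU : U * Uᵀ = 1) (B : κ → Matrix ι ι ℝ) :
    commSq (fun a => Uᵀ * B a * U) = commSq B := by
  simp only [commSq, lie_conj hU, frobSq_conj hU]

theorem exists_orthogonal_diagonal {X : Matrix ι ι ℝ} (hX : Xᵀ = X) :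
    ∃ (U : Matrix ι ι ℝ) (η : ι → ℝ), U * Uᵀ = 1 ∧ Uᵀ * X * U = diagonal η := by
  have hX' : X.IsHermitian := by
    rw [Matrix.IsHermitian, Matrix.conjTranspose_eq_transpose_of_trivial, hX]
  refine ⟨hX'.eigenvectorUnitary, hX'.eigenvalues, ?_, ?_⟩
  · have := Unitary.coe_mul_star_self hX'.eigenvectorUnitary
    rwa [Unitary.coe_star, Matrix.star_eq_conjTranspose,
      Matrix.conjTranspose_eq_transpose_of_trivial] at this
  · have := hX'.conjStarAlgAut_star_eigenvectorUnitary
    rw [Unitary.conjStarAlgAut_star_apply, Matrix.star_eq_conjTranspose,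
      Matrix.conjTranspose_eq_transpose_of_trivial] at this
    exact this

/-- A family of symmetric matrices is in normal position if its members are mutually orthogonal for
the Frobenius inner product, and one of largest norm, `B a₀`, is diagonal with entries `η`. -/
structure IsNormalPosition (B : κ → Matrix ι ι ℝ) (a₀ : κ) (η : ι → ℝ) : Prop where
  symm : ∀ a, (B a)ᵀ = B a
  orthogonal : ∀ a b, a ≠ b → ∑ i, ∑ j, B a i j * B b i j = 0
  frobSq_le : ∀ a, frobSq (B a) ≤ frobSq (B a₀)
  diagonal : B a₀ = Matrix.diagonal η

/-- Every family of symmetric matrices is brought into normal position by diagonalizing its Gram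
matrix and then its largest member. This changes neither `totalSq` nor `commSq`, and moves common
kernels to common kernels. -/
theorem exists_normalPosition [DecidableEq κ] [Nonempty κ] (B : κ → Matrix ι ι ℝ)
    (hB : ∀ a, (B a)ᵀ = B a) :
    ∃ (C : κ → Matrix ι ι ℝ) (a₀ : κ) (η : ι → ℝ), IsNormalPosition C a₀ η ∧
      totalSq C = totalSq B ∧ commSq C = commSq B ∧
      ((∃ v ≠ 0, ∀ a, C a *ᵥ v = 0) → ∃ v ≠ 0, ∀ a, B a *ᵥ v = 0) := by
  let Γ : Matrix κ κ ℝ := Matrix.of fun a b => ((B a)ᵀ * B b).trace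
  have hΓ : Γᵀ = Γ := by
    ext a b
    simp only [Γ, Matrix.transpose_apply, Matrix.of_apply, ← sum_mul_eq_trace, mul_comm]
  obtain ⟨O, μ, hO, hOΓ⟩ := exists_orthogonal_diagonal hΓ
  let D := rotate O B
  have hD : ∀ a, (D a)ᵀ = D a := by
    intro a
    simp [D, rotate, Matrix.transpose_sum, hB]
  have horth : ∀ a b, a ≠ b → ∑ i, ∑ j, D a i j * D b i j = 0 := by
    intro a b hab
    have h1 : (Oᵀ * Γ * O) a b = 0 := by rw [hOΓ, Matrix.diagonal_apply_ne _ hab]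
    rw [← h1]
    simp only [sum_mul_eq_trace, D, rotate, Matrix.transpose_sum, Matrix.transpose_smul,
      Finset.sum_mul, Finset.mul_sum, Matrix.smul_mul, Matrix.mul_smul, Matrix.trace_sum,
      Matrix.trace_smul, Matrix.mul_apply, Matrix.transpose_apply, Γ, Matrix.of_apply, smul_eq_mul]
    refine Finset.sum_congr rfl fun d _ => Finset.sum_congr rfl fun c _ => ?_
    ring
  obtain ⟨a₀, ha₀⟩ := Finite.exists_max fun a => frobSq (D a)
  obtain ⟨U, η, hU, hUη⟩ := exists_orthogonal_diagonal (hD a₀)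
  refine ⟨fun a => Uᵀ * D a * U, a₀, η, ⟨?_, ?_, ?_, hUη⟩, ?_, ?_, ?_⟩
  · intro a
    simp [Matrix.transpose_mul, hD, Matrix.mul_assoc]
  · intro a b hab
    rw [sum_mul_eq_trace]
    have : (Uᵀ * D a * U)ᵀ * (Uᵀ * D b * U) = Uᵀ * ((D a)ᵀ * D b * U) := by
      simp only [Matrix.transpose_mul, Matrix.transpose_transpose, Matrix.mul_assoc]
      rw [← Matrix.mul_assoc U Uᵀ, hU, Matrix.one_mul]
    rw [this, Matrix.trace_mul_comm, Matrix.mul_assoc, hU, Matrix.mul_one, ← sum_mul_eq_trace,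
      horth a b hab]
  · intro a
    simp only [frobSq_conj hU]
    exact ha₀ a
  · rw [totalSq_conj hU, totalSq_rotate hO]
  · rw [commSq_conj hU, commSq_rotate hO]
  · rintro ⟨v, hv0, hv⟩
    have hU' : Uᵀ * U = 1 := mul_eq_one_comm.mp hU
    have hO' : Oᵀ * O = 1 := mul_eq_one_comm.mp hO
    have hDv : ∀ a, D a *ᵥ (U *ᵥ v) = 0 := by
      intro a
      have h1 : U *ᵥ ((Uᵀ * D a * U) *ᵥ v) = D a *ᵥ (U *ᵥ v) := by
        rw [Matrix.mulVec_mulVec, Matrix.mulVec_mulVec]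
        simp only [← Matrix.mul_assoc]
        rw [hU, Matrix.one_mul]
      rw [← h1, hv a, Matrix.mulVec_zero]
    refine ⟨U *ᵥ v, ?_, ?_⟩
    · intro h
      apply hv0
      rw [← Matrix.one_mulVec v, ← hU', ← Matrix.mulVec_mulVec, h, Matrix.mulVec_zero]
    · intro a
      have hBD : B a = ∑ b, O a b • D b := by
        ext i j
        simp only [D, Matrix.sum_apply, Matrix.smul_apply, smul_eq_mul, rotate_apply,
          Finset.mul_sum, ← mul_assoc]
        rw [Finset.sum_comm]
        simp only [← Finset.sum_mul]
        have : ∀ c, ∑ b, O a b * O c b = (1 : Matrix κ κ ℝ) a c := by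
          intro c
          rw [← hO]; simp [Matrix.mul_apply]
        simp [this, Matrix.one_apply]
      rw [hBD, Matrix.sum_mulVec]
      refine Finset.sum_eq_zero fun b _ => ?_
      rw [Matrix.smul_mulVec, hDv, smul_zero]

end Frobenius

/-! ### First variation and the bound in normal position -/

section Criticality

variable {ι κ : Type*} [Fintype ι] [Fintype κ] [DecidableEq κ]

theorem frobSq_lie_comm (X Y : Matrix ι ι ℝ) : frobSq ⁅X, Y⁆ = frobSq ⁅Y, X⁆ := by
  have h : ⁅X, Y⁆ = (-1 : ℝ) • ⁅Y, X⁆ := by simp [Ring.lie_def]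
  rw [h, frobSq_smul]
  norm_num

theorem totalSq_rescale (B : κ → Matrix ι ι ℝ) (a : κ) (t : ℝ) :
    totalSq (fun b => (if b = a then t else 1) • B b) =
      totalSq B + (t ^ 2 - 1) * frobSq (B a) := by
  have h : ∀ b, frobSq ((if b = a then t else 1) • B b) =
      frobSq (B b) + if b = a then (t ^ 2 - 1) * frobSq (B b) else 0 := by
    intro b
    rw [frobSq_smul]
    split_ifs <;> ring
  simp only [totalSq, h, Finset.sum_add_distrib]
  simp

theorem commSq_rescale (B : κ → Matrix ι ι ℝ) (a : κ) (t : ℝ) :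
    commSq (fun b => (if b = a then t else 1) • B b) =
      commSq B + 2 * (t ^ 2 - 1) * ∑ b, frobSq ⁅B a, B b⁆ := by
  have h : ∀ b c, frobSq ⁅(if b = a then t else 1) • B b, (if c = a then t else 1) • B c⁆ =
      frobSq ⁅B b, B c⁆ + (if b = a then (t ^ 2 - 1) * frobSq ⁅B a, B c⁆ else 0)
        + (if c = a then (t ^ 2 - 1) * frobSq ⁅B a, B b⁆ else 0) := by
    intro b c
    rw [smul_lie_smul_matrix, frobSq_smul]
    by_cases hb : b = a <;> by_cases hc : c = a
    · have : frobSq ⁅B a, B a⁆ = 0 := by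
        rw [Ring.lie_def, sub_self, frobSq_eq_zero]
      subst hb; subst hc
      simp [this]
    · subst hb
      simp only [if_true, if_neg hc]
      ring
    · subst hc
      simp only [if_true, if_neg hb]
      rw [frobSq_lie_comm (B b) (B c)]
      ring
    · simp only [if_neg hb, if_neg hc]
      ring
  simp only [commSq, h, Finset.sum_add_distrib]
  have h1 : ∑ b, ∑ c, (if b = a then (t ^ 2 - 1) * frobSq ⁅B a, B c⁆ else 0) =
      (t ^ 2 - 1) * ∑ b, frobSq ⁅B a, B b⁆ := by
    rw [Finset.sum_comm, Finset.mul_sum]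
    simp
  have h2 : ∑ b, ∑ c, (if c = a then (t ^ 2 - 1) * frobSq ⁅B a, B b⁆ else 0) =
      (t ^ 2 - 1) * ∑ b, frobSq ⁅B a, B b⁆ := by
    rw [Finset.mul_sum]
    simp
  rw [h1, h2]
  ring

/-- The first variation of `M * totalSq ^ 2 - commSq` at a zero, where it is minimal, in the
direction that rescales the single member `B a`. -/
theorem sum_frobSq_lie_eq_of_extremal {M : ℝ} (hM : 0 ≤ M)
    (hbound : ∀ C : κ → Matrix ι ι ℝ, (∀ a, (C a)ᵀ = C a) → commSq C ≤ M * totalSq C ^ 2)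
    {B : κ → Matrix ι ι ℝ} (hB : ∀ a, (B a)ᵀ = B a) (hext : commSq B = M * totalSq B ^ 2)
    (a : κ) : ∑ b, frobSq ⁅B a, B b⁆ = M * totalSq B * frobSq (B a) := by
  set D := ∑ b, frobSq ⁅B a, B b⁆
  set N := frobSq (B a)
  set S := totalSq B
  have key : ∀ t : ℝ, 0 ≤ 2 * (t ^ 2 - 1) * (M * S * N - D) + (t ^ 2 - 1) ^ 2 * (M * N ^ 2) := by
    intro t
    have := hbound (fun b => (if b = a then t else 1) • B b) (by
      intro b
      rw [Matrix.transpose_smul, hB])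
    rw [totalSq_rescale, commSq_rescale, hext] at this
    simp only [D, N, S]
    nlinarith
  have hP : 0 ≤ M * N ^ 2 := by positivity
  set P := M * N ^ 2
  set Q := M * S * N - D with hQ
  have key' : ∀ u : ℝ, -1 ≤ u → 0 ≤ 2 * u * Q + u ^ 2 * P := by
    intro u hu
    have h := key (Real.sqrt (1 + u))
    rw [Real.sq_sqrt (by linarith)] at h
    simpa using h
  suffices Q = 0 by linarith
  clear_value P Q
  by_contra hne
  have hpos : 0 < P + |Q| := by positivity
  -- The step `-Q / (P + |Q|)` is admissible and makes the quadratic negative.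
  have hle : |Q| / (P + |Q|) ≤ 1 := (div_le_one hpos).mpr (by linarith)
  have habs : |Q / (P + |Q|)| ≤ 1 := by rwa [abs_div, abs_of_pos hpos]
  have h := key' (-(Q / (P + |Q|))) (by linarith [(abs_le.mp habs).2])
  have hQ2 : 0 < Q ^ 2 := by positivity
  have h2 : 2 * -(Q / (P + |Q|)) * Q + (-(Q / (P + |Q|))) ^ 2 * P =
      -(Q ^ 2 * (P + 2 * |Q|)) / (P + |Q|) ^ 2 := by
    field_simp
    ring
  rw [h2, le_div_iff₀ (by positivity)] at h
  have : 0 < Q ^ 2 * (P + 2 * |Q|) := by positivity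
  linarith

end Criticality

section NormalPosition

section

variable {ι κ : Type*} [Fintype ι] [DecidableEq ι] {B : κ → Matrix ι ι ℝ} {a₀ : κ} {η : ι → ℝ}

theorem frobSq_diagonal (η : ι → ℝ) : frobSq (diagonal η) = ∑ k, η k ^ 2 := by
  simp only [frobSq, Matrix.diagonal_apply, ite_pow]
  simp

theorem IsNormalPosition.apply_comm (h : IsNormalPosition B a₀ η) (a : κ) (i j : ι) :
    B a i j = B a j i := congrFun (congrFun (h.symm a).symm i) j

theorem IsNormalPosition.frobSq_eq (h : IsNormalPosition B a₀ η) :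
    frobSq (B a₀) = ∑ k, η k ^ 2 := by rw [h.diagonal, frobSq_diagonal]

end

variable {ι κ : Type*} [Fintype κ]

/-- The sum over the family of the squares of the `(i, j)` entries. -/
def entrySq (B : κ → Matrix ι ι ℝ) (i j : ι) : ℝ := ∑ a, B a i j ^ 2

theorem entrySq_nonneg (B : κ → Matrix ι ι ℝ) (i j : ι) : 0 ≤ entrySq B i j :=
  Finset.sum_nonneg fun _ _ => sq_nonneg _

variable [Fintype ι]

theorem totalSq_eq_sum_entrySq (B : κ → Matrix ι ι ℝ) :
    totalSq B = ∑ i, ∑ j, entrySq B i j := by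
  simp only [totalSq, frobSq, entrySq]
  rw [Finset.sum_comm]
  exact Finset.sum_congr rfl fun i _ => Finset.sum_comm

variable [DecidableEq ι]

theorem sum_frobSq_diagonal_lie (η : ι → ℝ) (B : κ → Matrix ι ι ℝ) :
    ∑ b, frobSq ⁅diagonal η, B b⁆ = ∑ i, ∑ j, (η i - η j) ^ 2 * entrySq B i j := by
  have h : ∀ b, frobSq ⁅diagonal η, B b⁆ = ∑ i, ∑ j, (η i - η j) ^ 2 * B b i j ^ 2 := by
    intro b
    refine Finset.sum_congr rfl fun i _ => Finset.sum_congr rfl fun j _ => ?_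
    rw [Ring.lie_def, Matrix.sub_apply, Matrix.diagonal_mul, Matrix.mul_diagonal]
    ring
  simp only [h, entrySq, Finset.mul_sum]
  rw [Finset.sum_comm]
  exact Finset.sum_congr rfl fun i _ => Finset.sum_comm

variable {B : κ → Matrix ι ι ℝ} {a₀ : κ} {η : ι → ℝ}

theorem IsNormalPosition.entrySq_comm (h : IsNormalPosition B a₀ η) (i j : ι) :
    entrySq B i j = entrySq B j i := by
  simp only [entrySq, h.apply_comm _ i j]

/-- Bessel's inequality for the orthogonal family `B` and the symmetric matrix with entries `1` in
the positions `(i, j)` and `(j, i)`, whose squared norm is `2`. -/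
theorem IsNormalPosition.entrySq_le (h : IsNormalPosition B a₀ η) {i j : ι} (hij : i ≠ j) :
    entrySq B i j ≤ (∑ k, η k ^ 2) / 2 := by
  classical
  rw [← h.frobSq_eq]
  set q := entrySq B i j with hq
  set N := frobSq (B a₀) with hN
  -- Comparing the norm of `X` with its entries `X i j = X j i = q` gives `2 * q ^ 2 ≤ q * N`.
  let X : Matrix ι ι ℝ := ∑ a, B a i j • B a
  have hX : frobSq X = ∑ a, B a i j ^ 2 * frobSq (B a) := by
    have h1 : frobSq X = (Xᵀ * X).trace := frobSq_eq_trace X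
    have h2 : ∀ a b, ((B a)ᵀ * B b).trace = if a = b then frobSq (B a) else 0 := by
      intro a b
      split_ifs with hab
      · rw [hab, frobSq_eq_trace]
      · rw [← sum_mul_eq_trace, h.orthogonal a b hab]
    rw [h1]
    simp only [X, Matrix.transpose_sum, Matrix.transpose_smul, Finset.sum_mul, Finset.mul_sum,
      Matrix.smul_mul, Matrix.mul_smul, Matrix.trace_sum, Matrix.trace_smul, h2, smul_eq_mul]
    simp only [mul_ite, mul_zero, Finset.sum_ite_eq', Finset.mem_univ, if_true]
    exact Finset.sum_congr rfl fun a _ => by ring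
  have hXij : X i j = q := by
    simp only [X, Matrix.sum_apply, Matrix.smul_apply, smul_eq_mul, hq, entrySq, sq]
  have hXji : X j i = q := by
    rw [← hXij]
    simp only [X, Matrix.sum_apply, Matrix.smul_apply, h.apply_comm _ j i]
  have hup : frobSq X ≤ q * N := by
    rw [hX, hq, entrySq, Finset.sum_mul]
    exact Finset.sum_le_sum fun a _ => mul_le_mul_of_nonneg_left (h.frobSq_le a) (sq_nonneg _)
  have hlow : 2 * q ^ 2 ≤ frobSq X := by
    have h1 : ∑ k ∈ {i, j}, ∑ l, X k l ^ 2 ≤ frobSq X :=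
      Finset.sum_le_univ_sum_of_nonneg fun k => Finset.sum_nonneg fun l _ => sq_nonneg _
    rw [Finset.sum_pair hij] at h1
    have h2 : X i j ^ 2 ≤ ∑ l, X i l ^ 2 :=
      Finset.single_le_sum (f := fun l => X i l ^ 2) (fun l _ => sq_nonneg _) (Finset.mem_univ j)
    have h3 : X j i ^ 2 ≤ ∑ l, X j l ^ 2 :=
      Finset.single_le_sum (f := fun l => X j l ^ 2) (fun l _ => sq_nonneg _) (Finset.mem_univ i)
    rw [hXij] at h2
    rw [hXji] at h3
    linarith
  have hq0 : 0 ≤ q := entrySq_nonneg B i j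
  rcases hq0.eq_or_lt with h0 | h0
  · rw [← h0]
    have := frobSq_nonneg (B a₀)
    positivity
  · nlinarith

theorem IsNormalPosition.sq_le_entrySq (h : IsNormalPosition B a₀ η) (i : ι) :
    η i ^ 2 ≤ entrySq B i i := by
  have h1 : B a₀ i i ^ 2 ≤ entrySq B i i :=
    Finset.single_le_sum (f := fun a => B a i i ^ 2) (fun _ _ => sq_nonneg _) (Finset.mem_univ a₀)
  rwa [h.diagonal, Matrix.diagonal_apply_eq] at h1

theorem totalSq_eq_offDiag_add (B : κ → Matrix ι ι ℝ) :
    totalSq B = (∑ i, ∑ j, if i = j then 0 else entrySq B i j) + ∑ i, entrySq B i i := by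
  rw [totalSq_eq_sum_entrySq, ← Finset.sum_add_distrib]
  refine Finset.sum_congr rfl fun i _ => ?_
  have : ∑ j, (if i = j then entrySq B i j else 0) = entrySq B i i := by simp
  rw [← this, ← Finset.sum_add_distrib]
  refine Finset.sum_congr rfl fun j _ => ?_
  split_ifs <;> simp

theorem IsNormalPosition.offDiag_add_le (h : IsNormalPosition B a₀ η) :
    (∑ i, ∑ j, if i = j then 0 else entrySq B i j) + ∑ k, η k ^ 2 ≤ totalSq B := by
  rw [totalSq_eq_offDiag_add]
  have := Finset.sum_le_sum fun i (_ : i ∈ Finset.univ) => h.sq_le_entrySq i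
  linarith

theorem IsNormalPosition.sum_frobSq_lie_le (h : IsNormalPosition B a₀ η)
    (hN : 0 < ∑ k, η k ^ 2) :
    ∑ b, frobSq ⁅B a₀, B b⁆ ≤ (∑ k, η k ^ 2) * totalSq B := by
  rw [h.diagonal, sum_frobSq_diagonal_lie]
  refine (sum_sq_sub_mul_le η _ h.entrySq_comm (entrySq_nonneg B)
    (fun i j hij => h.entrySq_le hij) hN).1.trans ?_
  have := mul_le_mul_of_nonneg_left h.offDiag_add_le hN.le
  linarith

end NormalPosition

/-! ### The DDVV inequality -/

section Inequality

variable {ι κ : Type*} [Fintype ι] [Fintype κ]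

theorem commSq_zero : commSq (0 : κ → Matrix ι ι ℝ) = 0 := by
  simpa using commSq_smul 0 (0 : κ → Matrix ι ι ℝ)

theorem continuous_totalSq : Continuous (totalSq : (κ → Matrix ι ι ℝ) → ℝ) := by
  unfold totalSq frobSq
  fun_prop

theorem continuous_commSq : Continuous (commSq : (κ → Matrix ι ι ℝ) → ℝ) := by
  unfold commSq frobSq
  simp only [Ring.lie_def, Matrix.sub_apply, Matrix.mul_apply]
  fun_prop

theorem isCompact_totalSq_sphere :
    IsCompact {B : κ → Matrix ι ι ℝ | (∀ a, (B a)ᵀ = B a) ∧ totalSq B = 1} := by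
  have hK : IsCompact (Set.pi Set.univ fun _ : κ => Set.pi Set.univ fun _ : ι =>
      Set.pi Set.univ fun _ : ι => Set.Icc (-1 : ℝ) 1) :=
    isCompact_univ_pi fun _ => isCompact_univ_pi fun _ => isCompact_univ_pi fun _ => isCompact_Icc
  have hcl : IsClosed {B : κ → Matrix ι ι ℝ | (∀ a, (B a)ᵀ = B a) ∧ totalSq B = 1} := by
    have h : {B : κ → Matrix ι ι ℝ | (∀ a, (B a)ᵀ = B a) ∧ totalSq B = 1} =
        (⋂ a, {B | (B a)ᵀ = B a}) ∩ {B | totalSq B = 1} := by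
      ext B
      simp
    rw [h]
    refine IsClosed.inter (isClosed_iInter fun a => isClosed_eq ?_ ?_)
      (isClosed_eq continuous_totalSq continuous_const) <;> fun_prop
  refine hK.of_isClosed_subset hcl ?_
  rintro B ⟨-, hB⟩ a - i - j -
  have h1 : frobSq (B a) ≤ totalSq B :=
    Finset.single_le_sum (f := fun a => frobSq (B a)) (fun _ _ => frobSq_nonneg _)
      (Finset.mem_univ a)
  have h2 : ∑ j, B a i j ^ 2 ≤ frobSq (B a) :=
    Finset.single_le_sum (f := fun i => ∑ j, B a i j ^ 2)
      (fun _ _ => Finset.sum_nonneg fun _ _ => sq_nonneg _) (Finset.mem_univ i)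
  have h3 : B a i j ^ 2 ≤ ∑ j, B a i j ^ 2 :=
    Finset.single_le_sum (f := fun j => B a i j ^ 2) (fun _ _ => sq_nonneg _) (Finset.mem_univ j)
  exact abs_le.mp (abs_le_one_iff_mul_self_le_one.mpr (by nlinarith))

theorem IsNormalPosition.sum_sq_pos [DecidableEq ι] {B : κ → Matrix ι ι ℝ} {a₀ : κ} {η : ι → ℝ}
    (h : IsNormalPosition B a₀ η) (hB : 0 < totalSq B) : 0 < ∑ k, η k ^ 2 := by
  by_contra hcon
  rw [← h.frobSq_eq] at hcon
  have : totalSq B ≤ 0 := Finset.sum_nonpos fun a _ => (h.frobSq_le a).trans (not_lt.mp hcon)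
  linarith

/-- The DDVV inequality. If `M` is the maximum of `commSq` on the unit sphere, the first variation
at a maximizer in normal position gives `M * N = ∑ b, frobSq ⁅B a₀, B b⁆ ≤ N`, so that `M ≤ 1`. -/
theorem commSq_le_totalSq_sq [DecidableEq ι] [DecidableEq κ] (B : κ → Matrix ι ι ℝ)
    (hB : ∀ a, (B a)ᵀ = B a) : commSq B ≤ totalSq B ^ 2 := by
  rcases (totalSq_nonneg B).eq_or_lt with h0 | h0
  · have : B = 0 := totalSq_eq_zero.mp h0.symm
    subst this
    simp [commSq_zero, totalSq_eq_zero.mpr rfl]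
  have hnorm : ∀ C : κ → Matrix ι ι ℝ, 0 < totalSq C →
      totalSq ((Real.sqrt (totalSq C))⁻¹ • C) = 1 := by
    intro C hC
    rw [totalSq_smul, inv_pow, Real.sq_sqrt hC.le, inv_mul_cancel₀ hC.ne']
  obtain ⟨E, ⟨hEs, hE1⟩, hEmax⟩ := (isCompact_totalSq_sphere (ι := ι) (κ := κ)).exists_isMaxOn
    ⟨(Real.sqrt (totalSq B))⁻¹ • B, fun a => by simp [hB], hnorm B h0⟩
    continuous_commSq.continuousOn
  set M := commSq E with hM
  have hM0 : 0 ≤ M := commSq_nonneg E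
  have hbound : ∀ C : κ → Matrix ι ι ℝ, (∀ a, (C a)ᵀ = C a) → commSq C ≤ M * totalSq C ^ 2 := by
    intro C hC
    rcases (totalSq_nonneg C).eq_or_lt with hC0 | hC0
    · have : C = 0 := totalSq_eq_zero.mp hC0.symm
      subst this
      simp [commSq_zero, totalSq_eq_zero.mpr rfl]
    have h1 : commSq ((Real.sqrt (totalSq C))⁻¹ • C) ≤ M :=
      hEmax ⟨fun a => by simp [hC], hnorm C hC0⟩
    have h4 : (Real.sqrt (totalSq C))⁻¹ ^ 4 = (totalSq C ^ 2)⁻¹ := by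
      rw [inv_pow, show 4 = 2 * 2 from rfl, pow_mul, Real.sq_sqrt hC0.le]
    rw [commSq_smul, h4, inv_mul_le_iff₀ (by positivity)] at h1
    linarith
  have hne : Nonempty κ := by
    by_contra h
    rw [not_nonempty_iff] at h
    simp [totalSq] at h0
  obtain ⟨C, a₀, η, hC, hCS, hCG, -⟩ := exists_normalPosition E hEs
  rw [hE1] at hCS
  have hN := hC.sum_sq_pos (by rw [hCS]; exact one_pos)
  have h1 := sum_frobSq_lie_eq_of_extremal hM0 hbound hC.symm (by rw [hCG, hCS]; simp [hM]) a₀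
  have h2 := hC.sum_frobSq_lie_le hN
  rw [h1, hC.frobSq_eq, hCS] at h2
  have hM1 : M ≤ 1 := by nlinarith
  calc commSq B ≤ M * totalSq B ^ 2 := hbound B hB
    _ ≤ 1 * totalSq B ^ 2 := mul_le_mul_of_nonneg_right hM1 (sq_nonneg _)
    _ = _ := one_mul _

end Inequality

/-! ### The equality case of the DDVV inequality -/

section Cross

variable {ι : Type*} [Fintype ι] [DecidableEq ι]

/-- The symmetric matrix whose row and column with index `o` are both `w`, and whose other entries
vanish. The entry `w o` is meant to be `0`. -/
def crossMatrix (o : ι) (w : ι → ℝ) : Matrix ι ι ℝ :=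
  Matrix.of fun i j => (if i = o then w j else 0) + if j = o then w i else 0

theorem frobSq_crossMatrix (o : ι) {w : ι → ℝ} (hw : w o = 0) :
    frobSq (crossMatrix o w) = 2 * ∑ i, w i ^ 2 := by
  have h : ∀ i j, crossMatrix o w i j ^ 2 =
      (if i = o then w j ^ 2 else 0) + if j = o then w i ^ 2 else 0 := by
    intro i j
    simp only [crossMatrix, Matrix.of_apply]
    by_cases hi : i = o <;> by_cases hj : j = o <;> simp [hi, hj, hw]
  simp only [frobSq, h, Finset.sum_add_distrib]
  rw [Finset.sum_comm]
  simp only [Finset.sum_ite_eq', Finset.mem_univ, if_true]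
  ring

theorem lie_crossMatrix (o : ι) {v w : ι → ℝ} (hv : v o = 0) (hw : w o = 0) :
    ⁅crossMatrix o v, crossMatrix o w⁆ = Matrix.of fun i j => v i * w j - w i * v j := by
  have h : ∀ {v w : ι → ℝ}, v o = 0 → w o = 0 → ∀ i j,
      (crossMatrix o v * crossMatrix o w) i j =
        v i * w j + if i = o ∧ j = o then ∑ k, v k * w k else 0 := by
    intro v w hv hw i j
    simp only [crossMatrix, Matrix.mul_apply, Matrix.of_apply, mul_add, add_mul, ite_mul, mul_ite,
      zero_mul, mul_zero, Finset.sum_add_distrib]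
    by_cases hi : i = o <;> by_cases hj : j = o <;> simp [hi, hj, hv, hw]
  ext i j
  rw [Ring.lie_def, Matrix.sub_apply, h hv hw, h hw hv, Matrix.of_apply]
  simp only [mul_comm (w _) (v _)]
  ring

theorem frobSq_lie_crossMatrix_le (o : ι) {v w : ι → ℝ} (hv : v o = 0) (hw : w o = 0) :
    frobSq ⁅crossMatrix o v, crossMatrix o w⁆ ≤
      frobSq (crossMatrix o v) * frobSq (crossMatrix o w) / 2 := by
  rw [lie_crossMatrix o hv hw, frobSq_crossMatrix o hv, frobSq_crossMatrix o hw]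
  have h : frobSq (Matrix.of fun i j => v i * w j - w i * v j) =
      2 * ((∑ i, v i ^ 2) * ∑ i, w i ^ 2) - 2 * (∑ i, v i * w i) ^ 2 := by
    simp only [frobSq, Matrix.of_apply]
    calc _ = ∑ i, ∑ j, (v i ^ 2 * w j ^ 2 + w i ^ 2 * v j ^ 2
            - 2 * ((v i * w i) * (v j * w j))) := by
          refine Finset.sum_congr rfl fun i _ => Finset.sum_congr rfl fun j _ => ?_
          ring
      _ = _ := by
          simp only [Finset.sum_sub_distrib, Finset.sum_add_distrib, ← Finset.mul_sum,
            ← Finset.sum_mul]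
          ring
  rw [h]
  nlinarith [sq_nonneg (∑ i, v i * w i)]

end Cross

section Equality

theorem entrySq_eq_zero_apply {ι κ : Type*} [Fintype κ] (B : κ → Matrix ι ι ℝ) {i j : ι}
    (h : entrySq B i j = 0) (a : κ) : B a i j = 0 :=
  pow_eq_zero_iff two_ne_zero |>.mp
    ((Finset.sum_eq_zero_iff_of_nonneg fun _ _ => sq_nonneg _).mp h a (Finset.mem_univ a))

variable {ι κ : Type*} [Fintype ι] [Fintype κ] [DecidableEq ι]

/-- A family in normal position that is critical in the direction of `B a₀` realizes equality in
`sum_sq_sub_mul_le`, and its diagonal entries all come from `B a₀`. -/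
theorem IsNormalPosition.exists_star_of_extremal {B : κ → Matrix ι ι ℝ} {a₀ : κ} {η : ι → ℝ}
    (h : IsNormalPosition B a₀ η) (hN : 0 < ∑ k, η k ^ 2)
    (hcrit : ∑ b, frobSq ⁅B a₀, B b⁆ = totalSq B * frobSq (B a₀)) :
    (∀ i, entrySq B i i = η i ^ 2) ∧
    ∃ (o : ι) (J : Finset ι) (y : ℝ), o ∉ J ∧ 0 < #J ∧ η o = -(#J * y) ∧
      (∀ j ∈ J, η j = y ∧ entrySq B o j = (∑ k, η k ^ 2) / 2) ∧
      (∀ k, k ≠ o → k ∉ J → η k = 0) ∧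
      (∀ i j, i ≠ j → (η i - η j) ^ 2 < ∑ k, η k ^ 2 → entrySq B i j = 0) ∧
      ∑ k, η k ^ 2 = (#J ^ 2 + #J) * y ^ 2 := by
  have hstar := sum_sq_sub_mul_le η (entrySq B) h.entrySq_comm (entrySq_nonneg B)
    (fun i j hij => h.entrySq_le hij) hN
  rw [h.frobSq_eq] at hcrit
  rw [h.diagonal, sum_frobSq_diagonal_lie] at hcrit
  rw [hcrit] at hstar
  obtain ⟨hle, heq⟩ := hstar
  have hoff := h.offDiag_add_le
  set N := ∑ k, η k ^ 2 with hNdef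
  set F := ∑ i, ∑ j, if i = j then 0 else entrySq B i j with hF
  have htot : totalSq B = F + N := by
    refine le_antisymm ?_ hoff
    have : N * totalSq B ≤ N * (F + N) := by linarith
    exact le_of_mul_le_mul_left this hN
  have hdiag : ∀ i, entrySq B i i = η i ^ 2 := by
    have h1 : ∑ i, η i ^ 2 = ∑ i, entrySq B i i := by
      have := totalSq_eq_offDiag_add B
      rw [← hF, htot] at this
      linarith
    intro i
    exact ((Finset.sum_eq_sum_iff_of_le fun i _ => h.sq_le_entrySq i).mp h1 i
      (Finset.mem_univ i)).symm
  refine ⟨hdiag, ?_⟩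
  obtain ⟨o, J, y, hoJ, hJ, ho, hy, hz, hq⟩ := heq (by rw [htot]; ring)
  refine ⟨o, J, y, hoJ, hJ, ho, hy, hz, hq, ?_⟩
  have h1 : ∑ k ∈ insert o J, η k ^ 2 = N :=
    Finset.sum_subset (Finset.subset_univ _) fun k _ hk => by
      rw [Finset.mem_insert, not_or] at hk
      rw [hz k hk.1 hk.2]
      norm_num
  rw [Finset.sum_insert hoJ, Finset.sum_congr rfl fun j hj => by rw [(hy j hj).1],
    Finset.sum_const, nsmul_eq_mul, ho] at h1
  rw [← h1]
  ring

/-- In a critical family the star cannot exhaust all indices when it has at least two leaves. All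
members other than `B a₀` would be crosses, whose mutual commutators are too small for the
criticality condition at such a member. -/
theorem IsNormalPosition.false_of_full_star [DecidableEq κ] {B : κ → Matrix ι ι ℝ} {a₀ : κ}
    {η : ι → ℝ}
    (h : IsNormalPosition B a₀ η) (hN : 0 < ∑ k, η k ^ 2)
    (hcrit : ∀ a, ∑ b, frobSq ⁅B a, B b⁆ = totalSq B * frobSq (B a))
    (hdiag : ∀ i, entrySq B i i = η i ^ 2) {o : ι} {J : Finset ι} {y : ℝ} (hoJ : o ∉ J)
    (hJ : 2 ≤ #J) (ho : η o = -(#J * y))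
    (hy : ∀ j ∈ J, η j = y ∧ entrySq B o j = (∑ k, η k ^ 2) / 2)
    (hfull : ∀ k, k ≠ o → k ∈ J)
    (hq : ∀ i j, i ≠ j → (η i - η j) ^ 2 < ∑ k, η k ^ 2 → entrySq B i j = 0)
    (hNy : ∑ k, η k ^ 2 = (#J ^ 2 + #J) * y ^ 2) : False := by
  have hoff := h.offDiag_add_le
  have hfN := h.frobSq_eq
  set N := ∑ k, η k ^ 2 with hNdef
  have hs : (2 : ℝ) ≤ #J := by exact_mod_cast hJ
  set s : ℝ := (#J : ℝ) with hsdef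
  -- Away from `a₀`, every member of the family is a cross with centre `o`.
  have hcross : ∀ b, b ≠ a₀ → B b = crossMatrix o (B b o) ∧ B b o o = 0 := by
    intro b hb
    have hd : ∀ i, B b i i = 0 := by
      intro i
      have h1 : ∑ a ∈ {a₀, b}, B a i i ^ 2 ≤ entrySq B i i :=
        Finset.sum_le_univ_sum_of_nonneg fun _ => sq_nonneg _
      rw [Finset.sum_pair (Ne.symm hb), hdiag, h.diagonal, Matrix.diagonal_apply_eq] at h1
      exact pow_eq_zero_iff two_ne_zero |>.mp
        (le_antisymm (by linarith : B b i i ^ 2 ≤ 0) (sq_nonneg _))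
    refine ⟨?_, hd o⟩
    ext i j
    simp only [crossMatrix, Matrix.of_apply]
    by_cases hi : i = o
    · subst hi
      by_cases hj : j = i
      · subst hj; simp [hd]
      · simp [hj]
    · by_cases hj : j = o
      · subst hj; simp [hi, h.apply_comm b i j]
      · simp only [hi, hj, if_false, add_zero]
        by_cases hij : i = j
        · rw [hij, hd]
        · refine entrySq_eq_zero_apply B (hq i j hij ?_) b
          rw [(hy i (hfull i hi)).1, (hy j (hfull j hj)).1, sub_self]
          simpa using hN
  obtain ⟨j, hjJ⟩ : J.Nonempty := Finset.card_pos.mp (by omega)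
  have hjo : j ≠ o := fun hj => hoJ (hj ▸ hjJ)
  obtain ⟨a, ha, haj⟩ : ∃ a, a ≠ a₀ ∧ B a o j ≠ 0 := by
    by_contra! hcon
    have h1 : entrySq B o j = 0 := by
      refine Finset.sum_eq_zero fun a _ => ?_
      by_cases haa : a = a₀
      · rw [haa, h.diagonal, Matrix.diagonal_apply_ne _ hjo.symm]; norm_num
      · rw [hcon a haa]; norm_num
    rw [(hy j hjJ).2] at h1
    linarith
  have hNa : 0 < frobSq (B a) := by
    refine (frobSq_nonneg _).lt_of_ne fun h0 => haj ?_
    rw [frobSq_eq_zero.mp h0.symm, Matrix.zero_apply]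
  obtain ⟨hac, hao⟩ := hcross a ha
  have h1 : frobSq ⁅B a, B a₀⁆ = ((s + 1) * y) ^ 2 * frobSq (B a) := by
    simp only [frobSq, Finset.mul_sum]
    refine Finset.sum_congr rfl fun i _ => Finset.sum_congr rfl fun k _ => ?_
    rw [h.diagonal, Ring.lie_def, Matrix.sub_apply, Matrix.diagonal_mul, Matrix.mul_diagonal]
    by_cases hi : i = o
    · by_cases hk : k = o
      · rw [hi, hk, hao]; ring
      · rw [hi, ho, (hy k (hfull k hk)).1]; ring
    · by_cases hk : k = o
      · rw [hk, ho, (hy i (hfull i hi)).1]; ring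
      · have : B a i k = 0 := by rw [hac]; simp [crossMatrix, hi, hk]
        rw [this]; ring
  have h2 : ∀ b, b ≠ a₀ → frobSq ⁅B a, B b⁆ ≤ frobSq (B a) / 2 * frobSq (B b) := by
    intro b hb
    obtain ⟨hbc, hbo⟩ := hcross b hb
    have := frobSq_lie_crossMatrix_le o hao hbo
    rw [← hac, ← hbc] at this
    linarith
  have h3 : totalSq B * frobSq (B a) ≤
      ((s + 1) * y) ^ 2 * frobSq (B a) + frobSq (B a) / 2 * (totalSq B - N) := by
    have h4 : totalSq B - N = ∑ b ∈ Finset.univ.erase a₀, frobSq (B b) := by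
      rw [totalSq, ← Finset.add_sum_erase _ _ (Finset.mem_univ a₀), hfN]
      ring
    rw [← hcrit a, ← Finset.add_sum_erase _ _ (Finset.mem_univ a₀), h1, h4, Finset.mul_sum]
    exact add_le_add le_rfl (Finset.sum_le_sum fun b hb => h2 b (Finset.ne_of_mem_erase hb))
  -- With `totalSq B ≥ (s + 1) * N` and `N = s * (s + 1) * y ^ 2` this forces `s ^ 2 ≤ 2`.
  have h5 : totalSq B + N ≤ 2 * ((s + 1) * y) ^ 2 := by
    have : frobSq (B a) * (totalSq B + N) ≤ frobSq (B a) * (2 * ((s + 1) * y) ^ 2) := by linarith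
    exact le_of_mul_le_mul_left this hNa
  have h6 : s * N ≤ ∑ i, ∑ j, if i = j then 0 else entrySq B i j := by
    have hnn : ∀ i j, 0 ≤ if i = j then 0 else entrySq B i j := by
      intro i j
      split_ifs
      exacts [le_rfl, entrySq_nonneg B i j]
    have h7 : ∑ i ∈ insert o J, (∑ j, if i = j then 0 else entrySq B i j) ≤
        ∑ i, ∑ j, if i = j then 0 else entrySq B i j :=
      Finset.sum_le_univ_sum_of_nonneg fun i => Finset.sum_nonneg fun j _ => hnn i j
    rw [Finset.sum_insert hoJ] at h7
    have h8 : s * (N / 2) ≤ ∑ j, if o = j then 0 else entrySq B o j := by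
      calc s * (N / 2) = ∑ j ∈ J, if o = j then 0 else entrySq B o j := by
            rw [hsdef, ← nsmul_eq_mul, ← Finset.sum_const]
            refine Finset.sum_congr rfl fun j hj => ?_
            have hoj : o ≠ j := fun hoj => hoJ (hoj ▸ hj)
            rw [if_neg hoj, (hy j hj).2]
        _ ≤ _ := Finset.sum_le_univ_sum_of_nonneg fun j => hnn o j
    have h9 : s * (N / 2) ≤ ∑ i ∈ J, ∑ j, if i = j then 0 else entrySq B i j := by
      rw [hsdef, ← nsmul_eq_mul, ← Finset.sum_const]
      refine Finset.sum_le_sum fun i hi => ?_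
      have hio : i ≠ o := fun hio => hoJ (hio ▸ hi)
      rw [← (hy i hi).2, h.entrySq_comm o i]
      have := Finset.single_le_sum (f := fun j => if i = j then 0 else entrySq B i j)
        (fun j _ => hnn i j) (Finset.mem_univ o)
      simpa only [if_neg hio] using this
    linarith
  have h7 : (s + 2) * ((s ^ 2 + s) * y ^ 2) ≤ 2 * ((s + 1) * y) ^ 2 := by
    rw [← hNy]; linarith
  clear_value s
  have hy2 : 0 < y ^ 2 := by
    rw [hNy] at hN
    exact pos_of_mul_pos_right hN (by nlinarith)
  have h8 : ((s + 1) * y ^ 2) * (s ^ 2 - 2) ≤ 0 := by linarith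
  have h9 : 0 < ((s + 1) * y ^ 2) * (s ^ 2 - 2) :=
    mul_pos (mul_pos (by linarith) hy2) (by nlinarith)
  linarith

/-- In the equality case of the DDVV inequality in size at least `3`, the matrices have a common
kernel vector: in normal position, a basis vector away from the star. -/
theorem exists_common_kernel_of_commSq_eq [DecidableEq κ] (B : κ → Matrix ι ι ℝ)
    (hB : ∀ a, (B a)ᵀ = B a)
    (hpos : 0 < totalSq B) (heq : commSq B = totalSq B ^ 2) (hcard : 3 ≤ Fintype.card ι) :
    ∃ v ≠ 0, ∀ a, B a *ᵥ v = 0 := by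
  have hne : Nonempty κ := by
    by_contra h
    rw [not_nonempty_iff] at h
    simp [totalSq] at hpos
  obtain ⟨C, a₀, η, hC, hCS, hCG, hker⟩ := exists_normalPosition B hB
  apply hker
  rw [← hCS] at hpos heq
  rw [← hCG] at heq
  have hN := hC.sum_sq_pos hpos
  have hcrit : ∀ a, ∑ b, frobSq ⁅C a, C b⁆ = totalSq C * frobSq (C a) := by
    intro a
    have := sum_frobSq_lie_eq_of_extremal zero_le_one
      (fun D hD => by rw [one_mul]; exact commSq_le_totalSq_sq D hD) hC.symm
      (by rw [one_mul, heq]) a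
    rwa [one_mul] at this
  obtain ⟨hdiag, o, J, y, hoJ, hJ, ho, hy, hz, hq, hNy⟩ := hC.exists_star_of_extremal hN (hcrit a₀)
  by_cases hfull : ∀ k, k ≠ o → k ∈ J
  · exfalso
    refine hC.false_of_full_star hN hcrit hdiag hoJ ?_ ho hy hfull hq hNy
    have : insert o J = Finset.univ := by
      ext k
      simp only [Finset.mem_insert, Finset.mem_univ, iff_true]
      by_cases hk : k = o
      exacts [Or.inl hk, Or.inr (hfull k hk)]
    have h2 := Finset.card_insert_of_notMem hoJ
    rw [this, Finset.card_univ] at h2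
    omega
  push Not at hfull
  obtain ⟨k, hko, hkJ⟩ := hfull
  refine ⟨Pi.single k 1, by simp, fun a => ?_⟩
  rw [Matrix.mulVec_single_one]
  ext i
  simp only [Matrix.col_apply, Pi.zero_apply]
  have hk0 := hz k hko hkJ
  have hs : (1 : ℝ) ≤ #J := by exact_mod_cast hJ
  have hy2 : 0 < y ^ 2 := by
    rw [hNy] at hN
    exact pos_of_mul_pos_right hN (by positivity)
  apply entrySq_eq_zero_apply
  by_cases hik : i = k
  · rw [hik, hdiag, hk0]; norm_num
  · apply hq i k hik
    rw [hk0, sub_zero]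
    by_cases hio : i = o
    · rw [hio, ho, hNy]
      nlinarith
    · by_cases hiJ : i ∈ J
      · rw [(hy i hiJ).1, hNy]
        nlinarith [mul_pos hy2 (by nlinarith : (0 : ℝ) < #J ^ 2 + #J - 1)]
      · rw [hz i hio hiJ]
        simpa using hN

end Equality

/-! ### Curvature in terms of the traceless part -/

section TracelessPart

variable {V W : Type*}
    [NormedAddCommGroup V] [InnerProductSpace ℝ V] [FiniteDimensional ℝ V]
    [NormedAddCommGroup W] [InnerProductSpace ℝ W]

theorem tracelessPart_comm (β : SymForm V W) (x y : V) :
    tracelessPart β x y = tracelessPart β y x := by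
  rw [tracelessPart_apply, tracelessPart_apply, β.2 x y, real_inner_comm]

theorem apply_eq_tracelessPart_add (β : SymForm V W) (x y : V) :
    β.1 x y = tracelessPart β x y + (inner ℝ x y : ℝ) • meanCurvatureVector β := by
  rw [tracelessPart_apply, sub_add_cancel]

theorem sum_tracelessPart_self (hn : 0 < finrank ℝ V) (β : SymForm V W) :
    ∑ i, tracelessPart β (stdOrthonormalBasis ℝ V i) (stdOrthonormalBasis ℝ V i) = 0 := by
  have hn' : (finrank ℝ V : ℝ) ≠ 0 := by positivity
  simp only [tracelessPart_apply, Finset.sum_sub_distrib, OrthonormalBasis.inner_eq_one, one_smul,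
    Finset.sum_const, Finset.card_univ, Fintype.card_fin, meanCurvatureVector, formTrace]
  rw [← Nat.cast_smul_eq_nsmul ℝ, smul_smul, mul_one_div_cancel hn', one_smul, sub_self]

/-- The Gauss equation for the Ricci tensor, with `β` split into its traceless part and its mean
curvature vector. -/
theorem ricci_apply (hn : 0 < finrank ℝ V) (c : ℝ) (β : SymForm V W) (x y : V) :
    (ricci c β).1 x y =
      ((finrank ℝ V : ℝ) - 1) * (c + meanCurvature β ^ 2) * inner ℝ x y
        + ((finrank ℝ V : ℝ) - 2) * inner ℝ (meanCurvatureVector β) (tracelessPart β x y)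
        - ∑ i, inner ℝ (tracelessPart β (stdOrthonormalBasis ℝ V i) x)
            (tracelessPart β (stdOrthonormalBasis ℝ V i) y) := by
  set e := stdOrthonormalBasis ℝ V with he
  set H := meanCurvatureVector β with hH
  set b := tracelessPart β with hb
  have hterm : ∀ i, curvature c β (e i) x (e i) y =
      (c + meanCurvature β ^ 2) * inner ℝ x y
        - (c + meanCurvature β ^ 2) * (inner ℝ x (e i) * inner ℝ (e i) y)
        + inner ℝ (b (e i) (e i)) (b x y) + inner ℝ (b (e i) (e i)) H * inner ℝ x y
        + inner ℝ H (b x y)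
        - inner ℝ H (b x ((inner ℝ (e i) y : ℝ) • e i))
        - inner ℝ H (b ((inner ℝ (e i) x : ℝ) • e i) y)
        - inner ℝ (b (e i) x) (b (e i) y) := by
    intro i
    have h1 : meanCurvature β ^ 2 = inner ℝ H H := (real_inner_self_eq_norm_sq H).symm
    have h2 : ∀ r s : ℝ, inner ℝ r s = r * s := fun r s => mul_comm s r
    simp only [curvature, kulkarniNomizu, apply_eq_tracelessPart_add, ← hb, ← hH,
      innerₗ_apply_apply,
      OrthonormalBasis.inner_eq_one, one_smul, h2, inner_add_left, inner_add_right,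
      real_inner_smul_left, real_inner_smul_right, map_smul, LinearMap.smul_apply, h1]
    rw [hb, tracelessPart_comm β x (e i), ← hb, real_inner_comm (b (e i) (e i)) (b x y),
      real_inner_comm (b (e i) (e i)) H, real_inner_comm H (b x y),
      real_inner_comm (b (e i) x) (b (e i) y), real_inner_comm H (b (e i) x),
      real_inner_comm H (b (e i) y), real_inner_comm x (e i)]
    ring
  have h0 : (ricci c β).1 x y = ∑ i, curvature c β (e i) x (e i) y := rfl
  rw [h0]
  simp only [hterm, Finset.sum_sub_distrib, Finset.sum_add_distrib, ← Finset.mul_sum,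
    ← Finset.sum_mul, ← sum_inner, ← inner_sum, ← map_sum, ← LinearMap.sum_apply,
    OrthonormalBasis.sum_repr', OrthonormalBasis.sum_inner_mul_inner, Finset.sum_const,
    Finset.card_univ, Fintype.card_fin]
  rw [hb, he, sum_tracelessPart_self hn]
  simp only [inner_zero_left, ← Nat.cast_smul_eq_nsmul ℝ, real_inner_smul_left]
  ring

theorem inner_ricciOperator (c : ℝ) (β : SymForm V W) (x y : V) :
    inner ℝ (ricciOperator c β x) y = 1 / ((finrank ℝ V : ℝ) - 1) * (ricci c β).1 x y := by
  rw [ricciOperator, inner_formOperator]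
  rfl

theorem ricciEigenvalue_monotone (c : ℝ) (β : SymForm V W) : Monotone (ricciEigenvalue c β) :=
  fun _ _ hij => (ricciOperator_isSymmetric c β).eigenvalues_antitone rfl (Fin.rev_le_rev.mpr hij)

variable [FiniteDimensional ℝ W]

/-- The components of the traceless part of `β` in the standard orthonormal bases: the matrices of
the traceless shape operators. -/
noncomputable def tracelessFamily (β : SymForm V W) (a : Fin (finrank ℝ W)) :
    Matrix (Fin (finrank ℝ V)) (Fin (finrank ℝ V)) ℝ :=
  Matrix.of fun i j => inner ℝ (tracelessPart β (stdOrthonormalBasis ℝ V i)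
    (stdOrthonormalBasis ℝ V j)) (stdOrthonormalBasis ℝ W a)

theorem transpose_tracelessFamily (β : SymForm V W) (a : Fin (finrank ℝ W)) :
    (tracelessFamily β a)ᵀ = tracelessFamily β a := by
  ext i j
  simp only [tracelessFamily, Matrix.transpose_apply, Matrix.of_apply]
  rw [tracelessPart_comm]

theorem totalSq_tracelessFamily (β : SymForm V W) :
    totalSq (tracelessFamily β) = ∑ i, ∑ j, ‖tracelessPart β (stdOrthonormalBasis ℝ V i)
      (stdOrthonormalBasis ℝ V j)‖ ^ 2 := by
  rw [totalSq_eq_sum_entrySq]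
  refine Finset.sum_congr rfl fun i _ => Finset.sum_congr rfl fun j _ => ?_
  rw [entrySq, ← (stdOrthonormalBasis ℝ W).sum_sq_inner_left]
  rfl

theorem totalSq_tracelessFamily_eq_zero_iff (β : SymForm V W) :
    totalSq (tracelessFamily β) = 0 ↔ IsUmbilical β := by
  rw [totalSq_tracelessFamily, IsUmbilical]
  constructor
  · intro h
    refine (stdOrthonormalBasis ℝ V).toBasis.ext fun i =>
      (stdOrthonormalBasis ℝ V).toBasis.ext fun j => ?_
    have h1 := (Finset.sum_eq_zero_iff_of_nonneg fun i _ =>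
      Finset.sum_nonneg fun j _ => sq_nonneg _).mp h i (Finset.mem_univ _)
    have h2 := (Finset.sum_eq_zero_iff_of_nonneg fun j _ => sq_nonneg _).mp h1 j (Finset.mem_univ _)
    simpa using h2
  · intro h
    simp [h]

/-- The shape operators differ from their traceless parts by multiples of the identity, so the
traceless parts have the same commutators. The sign comes from the order of composition. -/
theorem normalCurvature_eq_lie (β : SymForm V W) (i j : Fin (finrank ℝ V))
    (a b : Fin (finrank ℝ W)) :
    normalCurvature β (stdOrthonormalBasis ℝ V i) (stdOrthonormalBasis ℝ V j)
        (stdOrthonormalBasis ℝ W a) (stdOrthonormalBasis ℝ W b) =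
      -⁅tracelessFamily β a, tracelessFamily β b⁆ i j := by
  set e := stdOrthonormalBasis ℝ V with he
  set ξ := stdOrthonormalBasis ℝ W with hξ
  let h : Fin (finrank ℝ W) → ℝ := fun a => inner ℝ (meanCurvatureVector β) (ξ a)
  let A : Fin (finrank ℝ W) → Matrix (Fin (finrank ℝ V)) (Fin (finrank ℝ V)) ℝ :=
    fun a => tracelessFamily β a + h a • (1 : Matrix _ _ ℝ)
  have hA : ∀ a i j, A a i j = inner ℝ (β.1 (e i) (e j)) (ξ a) := by
    intro a i j
    simp only [A, h, tracelessFamily, apply_eq_tracelessPart_add, Matrix.add_apply, Matrix.of_apply,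
      Matrix.smul_apply, smul_eq_mul, inner_add_left, inner_smul_left, conj_trivial,
      Matrix.one_apply, ← he, ← hξ, orthonormal_iff_ite.mp e.orthonormal]
    ring
  have hmul : ∀ a b, inner ℝ (shapeOperator β (ξ a) (shapeOperator β (ξ b) (e i))) (e j) =
      (A b * A a) i j := by
    intro a b
    have hs : inner ℝ (shapeOperator β (ξ a) (shapeOperator β (ξ b) (e i))) (e j) =
        inner ℝ (shapeOperator β (ξ b) (e i)) (shapeOperator β (ξ a) (e j)) := by
      rw [inner_shapeOperator, real_inner_comm (shapeOperator β (ξ a) (e j)), inner_shapeOperator,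
        β.2]
    rw [hs, ← e.sum_inner_mul_inner, Matrix.mul_apply]
    refine Finset.sum_congr rfl fun k _ => ?_
    rw [inner_shapeOperator, real_inner_comm (shapeOperator β (ξ a) (e j)) (e k),
      inner_shapeOperator, hA, hA, β.2 (e j)]
  rw [normalCurvature, LinearMap.sub_apply, inner_sub_left, LinearMap.comp_apply,
    LinearMap.comp_apply, hmul, hmul, ← Matrix.sub_apply, ← Matrix.neg_apply]
  rw [Ring.lie_def, neg_sub]
  refine congrFun (congrFun ?_ i) j
  simp only [A, add_mul, mul_add, Matrix.smul_mul, Matrix.mul_smul, Matrix.one_mul,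
    Matrix.mul_one]
  rw [smul_comm (h b) (h a)]
  abel

theorem normalScalarCurvature_eq (β : SymForm V W) :
    normalScalarCurvature β = 1 / ((finrank ℝ V : ℝ) * ((finrank ℝ V : ℝ) - 1)) *
      Real.sqrt (commSq (tracelessFamily β)) := by
  rw [normalScalarCurvature]
  congr 2
  simp only [normalCurvature_eq_lie, neg_sq, commSq, frobSq]
  calc _ = ∑ i, ∑ a, ∑ j, ∑ b, ⁅tracelessFamily β a, tracelessFamily β b⁆ i j ^ 2 :=
        Finset.sum_congr rfl fun i _ => Finset.sum_comm
    _ = ∑ a, ∑ i, ∑ b, ∑ j, ⁅tracelessFamily β a, tracelessFamily β b⁆ i j ^ 2 := by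
        rw [Finset.sum_comm]
        exact Finset.sum_congr rfl fun a _ => Finset.sum_congr rfl fun i _ => Finset.sum_comm
    _ = _ := Finset.sum_congr rfl fun a _ => Finset.sum_comm

theorem sum_ricciEigenvalue (hn : 2 ≤ finrank ℝ V) (c : ℝ) (β : SymForm V W) :
    ∑ i, ricciEigenvalue c β i = finrank ℝ V * (c + meanCurvature β ^ 2)
      - totalSq (tracelessFamily β) / ((finrank ℝ V : ℝ) - 1) := by
  have hn' : ((finrank ℝ V : ℝ) - 1) ≠ 0 := by
    have : (2 : ℝ) ≤ finrank ℝ V := by exact_mod_cast hn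
    linarith
  have h1 : ∑ i, ricciEigenvalue c β i =
      ∑ i, (ricciOperator_isSymmetric c β).eigenvalues rfl i := by
    simp only [ricciEigenvalue]
    exact Equiv.sum_comp Fin.revPerm ((ricciOperator_isSymmetric c β).eigenvalues rfl)
  have h2 : LinearMap.trace ℝ V (ricciOperator c β) =
      ∑ i, (ricciOperator_isSymmetric c β).eigenvalues rfl i :=
    (ricciOperator_isSymmetric c β).trace_eq_sum_eigenvalues rfl
  have h3 : ∑ i, inner ℝ (meanCurvatureVector β) (tracelessPart β (stdOrthonormalBasis ℝ V i)
      (stdOrthonormalBasis ℝ V i)) = (0 : ℝ) := by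
    rw [← inner_sum, sum_tracelessPart_self (by omega), inner_zero_right]
  rw [h1, ← h2, LinearMap.trace_eq_sum_inner _ (stdOrthonormalBasis ℝ V)]
  rw [Finset.sum_congr rfl fun i _ => by rw [real_inner_comm, inner_ricciOperator],
    ← Finset.mul_sum]
  simp only [ricci_apply (by omega : 0 < finrank ℝ V), Finset.sum_sub_distrib,
    Finset.sum_add_distrib, ← Finset.mul_sum, h3, OrthonormalBasis.inner_eq_one,
    real_inner_self_eq_norm_sq, Finset.sum_const, Finset.card_univ, Fintype.card_fin, nsmul_eq_mul]
  rw [totalSq_tracelessFamily, Finset.sum_comm]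
  field_simp
  ring

theorem scalarCurvature_eq (hn : 2 ≤ finrank ℝ V) (c : ℝ) (β : SymForm V W) :
    scalarCurvature c β = c + meanCurvature β ^ 2
      - 1 / ((finrank ℝ V : ℝ) * ((finrank ℝ V : ℝ) - 1)) * totalSq (tracelessFamily β) := by
  have h2 : (2 : ℝ) ≤ finrank ℝ V := by exact_mod_cast hn
  have hn' : ((finrank ℝ V : ℝ) - 1) ≠ 0 := by linarith
  have hn0 : (finrank ℝ V : ℝ) ≠ 0 := by linarith
  rw [scalarCurvature, partialScalarCurvature, Finset.filter_true_of_mem fun i _ => i.2,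
    sum_ricciEigenvalue hn]
  field_simp

end TracelessPart

/-! ### Means of the smallest terms of a monotone family -/

section Mean

theorem card_mul_sum_sub_card_mul_sum {ι : Type*} [Fintype ι] [DecidableEq ι] (f : ι → ℝ)
    (s : Finset ι) :
    (#s : ℝ) * ∑ i, f i - Fintype.card ι * ∑ i ∈ s, f i = ∑ i ∈ s, ∑ j ∈ sᶜ, (f j - f i) := by
  have hc : (#sᶜ : ℝ) = Fintype.card ι - #s := by
    rw [← Finset.card_add_card_compl s]
    push_cast
    ring
  simp only [Finset.sum_sub_distrib, Finset.sum_const, nsmul_eq_mul, hc, ← Finset.mul_sum]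
  rw [← Finset.sum_add_sum_compl s f]
  ring

theorem card_filter_val_lt_of_le {n k : ℕ} (hk : k ≤ n) :
    #(Finset.univ.filter fun i : Fin n => (i : ℕ) < k) = k := by
  rw [Fin.card_filter_val_lt, min_eq_right hk]

theorem Monotone.mean_filter_lt_le {n : ℕ} {f : Fin n → ℝ} (hf : Monotone f) {k : ℕ}
    (hk0 : 1 ≤ k) (hk : k ≤ n) :
    1 / (k : ℝ) * ∑ i ∈ Finset.univ.filter (fun i : Fin n => (i : ℕ) < k), f i ≤
      1 / (n : ℝ) * ∑ i, f i := by
  have h0 := card_mul_sum_sub_card_mul_sum f (Finset.univ.filter fun i : Fin n => (i : ℕ) < k)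
  rw [card_filter_val_lt_of_le hk, Fintype.card_fin] at h0
  have hnn : 0 ≤ ∑ i ∈ Finset.univ.filter (fun i : Fin n => (i : ℕ) < k),
      ∑ j ∈ (Finset.univ.filter fun i : Fin n => (i : ℕ) < k)ᶜ, (f j - f i) := by
    refine Finset.sum_nonneg fun i hi => Finset.sum_nonneg fun j hj => ?_
    simp only [Finset.mem_compl, Finset.mem_filter, Finset.mem_univ, true_and] at hi hj
    exact sub_nonneg.mpr (hf (Fin.le_def.mpr (by omega)))
  have hk' : (0 : ℝ) < k := by exact_mod_cast hk0
  have hn' : (0 : ℝ) < n := by exact_mod_cast (by omega : 0 < n)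
  rw [one_div_mul_eq_div, one_div_mul_eq_div, div_le_div_iff₀ hk' hn']
  linarith

theorem Monotone.eq_of_mean_filter_lt_eq {n : ℕ} {f : Fin n → ℝ} (hf : Monotone f) {k : ℕ}
    (hk0 : 1 ≤ k) (hk : k < n)
    (h : 1 / (k : ℝ) * ∑ i ∈ Finset.univ.filter (fun i : Fin n => (i : ℕ) < k), f i =
      1 / (n : ℝ) * ∑ i, f i) (i j : Fin n) : f i = f j := by
  have hk' : (0 : ℝ) < k := by exact_mod_cast hk0
  have hn' : (0 : ℝ) < n := by exact_mod_cast (by omega : 0 < n)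
  rw [one_div_mul_eq_div, one_div_mul_eq_div, div_eq_div_iff hk'.ne' hn'.ne'] at h
  have h0 := card_mul_sum_sub_card_mul_sum f (Finset.univ.filter fun i : Fin n => (i : ℕ) < k)
  rw [card_filter_val_lt_of_le hk.le, Fintype.card_fin, sub_eq_zero.mpr (by linarith)] at h0
  have hnn : ∀ i ∈ Finset.univ.filter (fun i : Fin n => (i : ℕ) < k),
      ∀ j ∈ (Finset.univ.filter fun i : Fin n => (i : ℕ) < k)ᶜ, 0 ≤ f j - f i := by
    intro i hi j hj
    simp only [Finset.mem_compl, Finset.mem_filter, Finset.mem_univ, true_and] at hi hj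
    exact sub_nonneg.mpr (hf (Fin.le_def.mpr (by omega)))
  have hall : ∀ i j : Fin n, (i : ℕ) < k → ¬ (j : ℕ) < k → f j = f i := by
    intro i j hi hj
    have h1 := (Finset.sum_eq_zero_iff_of_nonneg fun i hi => Finset.sum_nonneg (hnn i hi)).mp
      h0.symm i (by simpa using hi)
    exact sub_eq_zero.mp ((Finset.sum_eq_zero_iff_of_nonneg (hnn i (by simpa using hi))).mp h1 j
      (by simpa using hj))
  have hconst : ∀ i, f i = f ⟨0, by omega⟩ := by
    intro i
    by_cases hi : (i : ℕ) < k
    · rw [← hall i ⟨k, hk⟩ hi (lt_irrefl k), hall ⟨0, by omega⟩ ⟨k, hk⟩ hk0 (lt_irrefl k)]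
    · exact hall _ i hk0 hi
  rw [hconst i, hconst j]

end Mean

/-! ### Comparison of the curvatures -/

section Comparison

variable {V W : Type*}
    [NormedAddCommGroup V] [InnerProductSpace ℝ V] [FiniteDimensional ℝ V]
    [NormedAddCommGroup W] [InnerProductSpace ℝ W]

theorem exists_unit_ricciEigenvalue_eq (c : ℝ) (β : SymForm V W) (i : Fin (finrank ℝ V)) :
    ∃ u : V, inner ℝ u u = (1 : ℝ) ∧
      ricciEigenvalue c β i = 1 / ((finrank ℝ V : ℝ) - 1) * (ricci c β).1 u u := by
  set hT := ricciOperator_isSymmetric c β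
  refine ⟨hT.eigenvectorBasis rfl i.rev, OrthonormalBasis.inner_eq_one _ _, ?_⟩
  rw [← inner_ricciOperator, hT.apply_eigenvectorBasis, real_inner_smul_left,
    OrthonormalBasis.inner_eq_one, mul_one]
  rfl

/-- If all eigenvalues of the normalized Ricci operator coincide, the Ricci tensor is a multiple of
the inner product. -/
theorem ricci_self_eq_of_ricciEigenvalue_eq {c : ℝ} {β : SymForm V W} {τ : ℝ}
    (hn : 2 ≤ finrank ℝ V) (hτ : ∀ i, ricciEigenvalue c β i = τ) (x : V) :
    (ricci c β).1 x x = ((finrank ℝ V : ℝ) - 1) * τ * inner ℝ x x := by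
  have h2 : (2 : ℝ) ≤ finrank ℝ V := by exact_mod_cast hn
  have hn' : ((finrank ℝ V : ℝ) - 1) ≠ 0 := by linarith
  set hT := ricciOperator_isSymmetric c β
  have hid : ricciOperator c β = τ • LinearMap.id := by
    refine (hT.eigenvectorBasis rfl).toBasis.ext fun i => ?_
    have h := hτ i.rev
    rw [ricciEigenvalue, Fin.rev_rev] at h
    rw [OrthonormalBasis.coe_toBasis, hT.apply_eigenvectorBasis, h]
    rfl
  have h := inner_ricciOperator c β x x
  rw [hid, LinearMap.smul_apply, LinearMap.id_apply, real_inner_smul_left] at h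
  rw [mul_assoc, h]
  field_simp

theorem ricciEigenvalue_eq_of_isUmbilical (hn : 2 ≤ finrank ℝ V) {β : SymForm V W}
    (h : IsUmbilical β) (c : ℝ) (i : Fin (finrank ℝ V)) :
    ricciEigenvalue c β i = c + meanCurvature β ^ 2 := by
  have h2 : (2 : ℝ) ≤ finrank ℝ V := by exact_mod_cast hn
  have hn' : ((finrank ℝ V : ℝ) - 1) ≠ 0 := by linarith
  obtain ⟨u, hu, hi⟩ := exists_unit_ricciEigenvalue_eq c β i
  have h0 : tracelessPart β = 0 := h
  rw [hi, ricci_apply (by omega), hu, h0]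
  simp only [LinearMap.zero_apply, inner_zero_right, Finset.sum_const_zero]
  field_simp
  ring

theorem partialScalarCurvature_le (c : ℝ) (β : SymForm V W) {k : ℕ} (hk0 : 1 ≤ k)
    (hk : k ≤ finrank ℝ V) : partialScalarCurvature c k β ≤ scalarCurvature c β := by
  rw [scalarCurvature, partialScalarCurvature, partialScalarCurvature,
    Finset.filter_true_of_mem (p := fun i : Fin (finrank ℝ V) => (i : ℕ) < finrank ℝ V)
      fun i _ => i.2]
  exact (ricciEigenvalue_monotone c β).mean_filter_lt_le hk0 hk

theorem ricciEigenvalue_eq_of_partialScalarCurvature_eq {c : ℝ} {β : SymForm V W} {k : ℕ}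
    (hk0 : 1 ≤ k) (hk : k < finrank ℝ V)
    (h : partialScalarCurvature c k β = scalarCurvature c β) (i : Fin (finrank ℝ V)) :
    ricciEigenvalue c β i = scalarCurvature c β := by
  rw [scalarCurvature, partialScalarCurvature, partialScalarCurvature,
    Finset.filter_true_of_mem (p := fun i : Fin (finrank ℝ V) => (i : ℕ) < finrank ℝ V)
      fun i _ => i.2] at h
  have hconst := (ricciEigenvalue_monotone c β).eq_of_mean_filter_lt_eq hk0 hk h
  have hn : (finrank ℝ V : ℝ) ≠ 0 := by exact_mod_cast (by omega : finrank ℝ V ≠ 0)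
  rw [scalarCurvature, partialScalarCurvature, Finset.filter_true_of_mem fun i _ => i.2,
    Finset.sum_congr rfl fun j _ => hconst j i, Finset.sum_const, Finset.card_univ,
    Fintype.card_fin, nsmul_eq_mul]
  field_simp

variable [FiniteDimensional ℝ W]

/-- In the equality case of the DDVV inequality for a nonzero traceless part, there is a direction
in which the Ricci tensor takes the value it has for an umbilical form. -/
theorem exists_ricci_self_eq_of_commSq_eq (hn : 3 ≤ finrank ℝ V) (β : SymForm V W) (c : ℝ)
    (hpos : 0 < totalSq (tracelessFamily β))
    (heq : commSq (tracelessFamily β) = totalSq (tracelessFamily β) ^ 2) :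
    ∃ x : V, x ≠ 0 ∧ (ricci c β).1 x x =
      ((finrank ℝ V : ℝ) - 1) * (c + meanCurvature β ^ 2) * inner ℝ x x := by
  obtain ⟨v, hv0, hv⟩ := exists_common_kernel_of_commSq_eq _ (transpose_tracelessFamily β) hpos heq
    (by simpa using hn)
  set e := stdOrthonormalBasis ℝ V with he
  set x : V := ∑ j, v j • e j with hx
  have hker : ∀ i, tracelessPart β (e i) x = 0 := by
    intro i
    refine InnerProductSpace.ext_inner_right_basis (𝕜 := ℝ) (stdOrthonormalBasis ℝ W).toBasis
      fun a => ?_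
    have h := congrFun (hv a) i
    simp only [Matrix.mulVec, dotProduct, tracelessFamily, Matrix.of_apply, Pi.zero_apply] at h
    simp only [hx, map_sum, map_smul, sum_inner, real_inner_smul_left, inner_zero_left,
      OrthonormalBasis.coe_toBasis]
    rw [← h]
    exact Finset.sum_congr rfl fun j _ => mul_comm _ _
  have hself : tracelessPart β x x = 0 := by
    nth_rewrite 1 [hx]
    simp only [map_sum, map_smul, LinearMap.sum_apply, LinearMap.smul_apply, hker, smul_zero,
      Finset.sum_const_zero]
  refine ⟨x, fun h0 => hv0 ?_, ?_⟩
  · have := Fintype.linearIndependent_iff.mp e.orthonormal.linearIndependent v h0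
    exact funext this
  · rw [ricci_apply (by omega), hself]
    simp only [← he, hker, inner_zero_right, Finset.sum_const_zero]
    ring

theorem sqrt_commSq_le (β : SymForm V W) :
    Real.sqrt (commSq (tracelessFamily β)) ≤ totalSq (tracelessFamily β) :=
  Real.sqrt_le_iff.mpr
    ⟨totalSq_nonneg _, commSq_le_totalSq_sq _ (transpose_tracelessFamily β)⟩

theorem normalScalarCurvature_eq_zero_of_isUmbilical {β : SymForm V W} (h : IsUmbilical β) :
    normalScalarCurvature β = 0 := by
  have h1 := sqrt_commSq_le β
  rw [(totalSq_tracelessFamily_eq_zero_iff β).mpr h] at h1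
  rw [normalScalarCurvature_eq, le_antisymm h1 (Real.sqrt_nonneg _), mul_zero]

/-- If the Ricci tensor is a multiple of the inner product, the multiple can be read off in the
direction of `exists_ricci_self_eq_of_commSq_eq`, and its trace then shows that the traceless part
vanishes. -/
theorem isUmbilical_of_partialScalarCurvature_eq (hn : 3 ≤ finrank ℝ V) {c : ℝ} {β : SymForm V W}
    {k : ℕ} (hk0 : 1 ≤ k) (hk : k < finrank ℝ V)
    (hρ : partialScalarCurvature c k β = scalarCurvature c β)
    (heq : commSq (tracelessFamily β) = totalSq (tracelessFamily β) ^ 2) : IsUmbilical β := by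
  rw [← totalSq_tracelessFamily_eq_zero_iff]
  by_contra hne
  have hpos := (totalSq_nonneg (tracelessFamily β)).lt_of_ne (Ne.symm hne)
  obtain ⟨x, hx0, hx⟩ := exists_ricci_self_eq_of_commSq_eq hn β c hpos heq
  rw [ricci_self_eq_of_ricciEigenvalue_eq (by omega)
    (ricciEigenvalue_eq_of_partialScalarCurvature_eq hk0 hk hρ)] at hx
  have h3 : (3 : ℝ) ≤ finrank ℝ V := by exact_mod_cast hn
  have hxx : (inner ℝ x x : ℝ) ≠ 0 := inner_self_ne_zero.mpr hx0
  have h1 : scalarCurvature c β = c + meanCurvature β ^ 2 :=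
    mul_left_cancel₀ (by linarith) (mul_right_cancel₀ hxx hx)
  rw [scalarCurvature_eq (by omega)] at h1
  have h2 : 0 < 1 / ((finrank ℝ V : ℝ) * ((finrank ℝ V : ℝ) - 1)) *
      totalSq (tracelessFamily β) :=
    mul_pos (one_div_pos.mpr (mul_pos (by linarith) (by linarith))) hpos
  linarith

end Comparison

end

theorem proposition3p2 {V W : Type*}
    [NormedAddCommGroup V] [InnerProductSpace ℝ V] [FiniteDimensional ℝ V]
    [NormedAddCommGroup W] [InnerProductSpace ℝ W] [FiniteDimensional ℝ W]
    (hn : 2 ≤ finrank ℝ V) (hm : 1 ≤ finrank ℝ W) (β : SymForm V W) (c : ℝ) :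
    (3 ≤ finrank ℝ V → ∀ k : ℕ, 1 ≤ k → k ≤ finrank ℝ V - 1 →
      partialScalarCurvature c k β ≤ c + meanCurvature β ^ 2 - normalScalarCurvature β ∧
      (partialScalarCurvature c k β = c + meanCurvature β ^ 2 - normalScalarCurvature β ↔
        IsUmbilical β)) ∧
    (∀ l : ℝ, 0 ≤ l → l < 1 →
      scalarCurvature c β ≤ c + meanCurvature β ^ 2 - l * normalScalarCurvature β ∧
      (scalarCurvature c β = c + meanCurvature β ^ 2 - l * normalScalarCurvature β ↔
        IsUmbilical β)) := by
  have h2 : (2 : ℝ) ≤ finrank ℝ V := by exact_mod_cast hn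
  have hκ : 0 < 1 / ((finrank ℝ V : ℝ) * ((finrank ℝ V : ℝ) - 1)) :=
    one_div_pos.mpr (mul_pos (by linarith) (by linarith))
  have hρ := scalarCurvature_eq hn c β
  have hρ' := normalScalarCurvature_eq β
  have hddvv := sqrt_commSq_le β
  have hS := totalSq_nonneg (tracelessFamily β)
  set κ := 1 / ((finrank ℝ V : ℝ) * ((finrank ℝ V : ℝ) - 1))
  set S := totalSq (tracelessFamily β) with hSdef
  have hle := mul_le_mul_of_nonneg_left hddvv hκ.le
  have hκS : 0 ≤ κ * S := mul_nonneg hκ.le hS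
  constructor
  · intro hn3 k hk0 hk
    have hpart := partialScalarCurvature_le c β hk0 (by omega : k ≤ finrank ℝ V)
    refine ⟨by linarith, fun heq => ?_, fun hu => ?_⟩
    · refine isUmbilical_of_partialScalarCurvature_eq hn3 hk0 (by omega) (c := c) (by linarith) ?_
      have h1 : κ * Real.sqrt (commSq (tracelessFamily β)) = κ * S := by linarith
      rw [← hSdef, ← mul_left_cancel₀ hκ.ne' h1, Real.sq_sqrt (commSq_nonneg _)]
    · rw [normalScalarCurvature_eq_zero_of_isUmbilical hu, partialScalarCurvature,
        Finset.sum_congr rfl fun i _ => ricciEigenvalue_eq_of_isUmbilical hn hu c i, Finset.sum_const,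
        card_filter_val_lt_of_le (by omega), nsmul_eq_mul]
      have hk' : (k : ℝ) ≠ 0 := by exact_mod_cast (by omega : k ≠ 0)
      field_simp
      ring
  · intro l hl0 hl1
    have hl : l * (κ * Real.sqrt (commSq (tracelessFamily β))) ≤ l * (κ * S) :=
      mul_le_mul_of_nonneg_left hle hl0
    refine ⟨by nlinarith, fun heq => ?_, fun hu => ?_⟩
    · rw [← totalSq_tracelessFamily_eq_zero_iff, ← hSdef]
      rw [hρ, hρ'] at heq
      have h1 : κ * S ≤ 0 := by nlinarith
      exact (mul_eq_zero.mp (le_antisymm h1 hκS)).resolve_left hκ.ne'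
    · have h0 : S = 0 := (totalSq_tracelessFamily_eq_zero_iff β).mpr hu
      rw [hρ, normalScalarCurvature_eq_zero_of_isUmbilical hu, h0]
      ring
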